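/- **Proposition 2 (powers of Gaussian variables).** Let $G$ be a standard Gaussian random variable, let $p>0$, set $Z=\operatorname{sign}(G)|G|^p$, let $(Z_i)_{i\ge 1}$ be independent random variables with the same law as $Z$, and let $S_n=\frac1n\sum_{i=1}^n Z_i$. (i) If $p\in(0,2]$, then $(S_n)_{n\ge1}$ satisfies a large deviations principle at speed $n$ with rate function $$J(x)=\sup_{\eta\in\mathbb R}\{\eta x-\lambda(\eta)\},\qquad \lambda(\eta)=\log\mathbb E\big[e^{\eta Z}\big]\in(-\infty,+\infty].$$ (ii) If $p>2$, then $(S_n)_{n\ge1}$ satisfies a large deviations principle at speed $n^{2/p}$ with rate function $$I_{2/p}(x)=\frac{|x|^{2/p}}{2}.$$ Here $(S_n)$ satisfies a large deviations principle at speed $v_n$ with rate function $I:\mathbb R\to[0,+\infty]$ if $I$ is lower semicontinuous and, for every Borel set $B\subset\mathbb R$, $$-\inf_{\mathring B} I\le\liminf_{n\to\infty}\frac1{v_n}\log\mathbb P(S_n\in B)\le\limsup_{n\to\infty}\frac1{v_n}\log\mathbb P(S_n\in B)\le-\inf_{\overline B} I,$$ where $\mathring B$ and $\overline B$ are the interior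 and the closure of $B$, $\log 0=-\infty$ and $\inf_\emptyset I=+\infty$. -/

import Mathlib

open MeasureTheory ProbabilityTheory Filter Topology
open scoped ENNReal

noncomputable section

/-- The signed power `sign(x) |x|^p`. -/
def signedPow (p x : ℝ) : ℝ := Real.sign x * |x| ^ p

/-- The empirical mean `(1/n) ∑_{i<n} X_i` of the first `n` samples. -/
def empiricalMean {Ω : Type*} (X : ℕ → Ω → ℝ) (n : ℕ) (ω : Ω) : ℝ :=
  (1 / (n : ℝ)) * ∑ i ∈ Finset.range n, X i ω

/-- The free energy `log E[exp (η X)]`, valued in the extended reals: it is `⊤` exactly when the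
exponential moment is infinite. -/
def freeEnergy {Ω : Type*} [MeasurableSpace Ω] (P : Measure Ω) (X : Ω → ℝ) (η : ℝ) : EReal :=
  ENNReal.log (∫⁻ ω, ENNReal.ofReal (Real.exp (η * X ω)) ∂P)

/-- The Legendre transform `sup_η (η x - Λ(η))` of an extended-real valued function. -/
def legendreTransform (Λ : ℝ → EReal) (x : ℝ) : EReal :=
  ⨆ η : ℝ, (((η * x : ℝ) : EReal) - Λ η)

/-- Large deviations principle for the random variables `Y n` at speed `v n` with rate function
`I`. Here `ENNReal.log 0 = ⊥`, and an infimum over the empty set is `⊤`. -/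
structure SatisfiesLDP {Ω E : Type*} [MeasurableSpace Ω] [TopologicalSpace E] [MeasurableSpace E]
    [BorelSpace E] (P : Measure Ω) (Y : ℕ → Ω → E) (v : ℕ → ℝ) (I : E → EReal) : Prop where
  nonneg : ∀ x, 0 ≤ I x
  lowerSemicontinuous : LowerSemicontinuous I
  lower_bound : ∀ B : Set E, MeasurableSet B →
    -(⨅ x ∈ interior B, I x) ≤
      liminf (fun n : ℕ => ENNReal.log (P {ω | Y n ω ∈ B}) / (v n : EReal)) atTop
  upper_bound : ∀ B : Set E, MeasurableSet B →
    limsup (fun n : ℕ => ENNReal.log (P {ω | Y n ω ∈ B}) / (v n : EReal)) atTop ≤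
      -(⨅ x ∈ closure B, I x)

end

/-!
The rate function of the sample means is decided by how a deviation is produced.

Cramér's theorem holds for every law on the line. The event that the Legendre transform at the mean
exceeds `d` is a union of half-lines, each of probability at most `exp (-d n)` by the Chernoff
bound, and the half-lines pointing in one direction increase to their union; so two Chernoff bounds
suffice, and no exponential moment has to be finite. For the lower bound at `x`, recentre at `x`
and restrict the law to a ball so large that the minimum of its moment generating function is still
almost `exp (-I x)`. The minimiser `η` exists when both half-lines are charged, the derivative
vanishes there, and the law tilted by `η` is therefore centred: its sums concentrate near `0`, and
undoing the tilt costs a factor `exp (|η| δ n)`. If a half-line is null, the infimum is the mass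
of the atom at `0`.

When the tails decay like `exp (-κ t ^ α)` with `α < 1`, a large sum is due to one big jump. Either
some summand exceeds `n a`, or the summands can be truncated at `n a`, and then Chernoff's bound
with parameter of order `n ^ (α - 1)` has the exponent of a single jump up to a correction
`n ^ (2 α - 1) = o(n ^ α)`. Conversely, one summand near `n x`, while the law of large numbers holds
for the others, realises the deviation. A power `p > 2` of a Gaussian variable has such tails with
`κ = 1 / 2` and `α = 2 / p`.
-/

section LargeDeviations

open Set

theorem eventually_mul_exp_le_exp {K b c : ℝ} (hcb : c < b) {ι : Type*} {l : Filter ι}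
    {v : ι → ℝ} (hv : Tendsto v l atTop) :
    ∀ᶠ i in l, K * Real.exp (-b * v i) ≤ Real.exp (-c * v i) := by
  have h : Tendsto (fun i => Real.exp ((b - c) * v i)) l atTop :=
    Real.tendsto_exp_atTop.comp (hv.const_mul_atTop (sub_pos.mpr hcb))
  filter_upwards [h.eventually_ge_atTop K] with i hi
  calc K * Real.exp (-b * v i) ≤ Real.exp ((b - c) * v i) * Real.exp (-b * v i) := by gcongr
    _ = Real.exp (-c * v i) := by rw [← Real.exp_add]; ring_nf

theorem log_ofReal_exp (x : ℝ) : ENNReal.log (ENNReal.ofReal (Real.exp x)) = x := by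
  rw [ENNReal.log_ofReal_of_pos (Real.exp_pos x), Real.log_exp]

theorem SatisfiesLDP.of_eventually_bounds {Ω E : Type*} [MeasurableSpace Ω] [TopologicalSpace E]
    [MeasurableSpace E] [BorelSpace E] {P : Measure Ω} [IsFiniteMeasure P] {Y : ℕ → Ω → E}
    {v : ℕ → ℝ} {I : E → EReal} (hv : ∀ᶠ n in atTop, 0 < v n) (hI : ∀ x, 0 ≤ I x)
    (hI_lsc : LowerSemicontinuous I)
    (h_upper : ∀ F : Set E, IsClosed F → ∀ c : ℝ, (c : EReal) < ⨅ x ∈ F, I x →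
      ∀ᶠ n in atTop, P.real {ω | Y n ω ∈ F} ≤ Real.exp (-c * v n))
    (h_lower : ∀ U : Set E, IsOpen U → ∀ x ∈ U, ∀ c : ℝ, I x < c →
      ∀ᶠ n in atTop, Real.exp (-c * v n) ≤ P.real {ω | Y n ω ∈ U}) :
    SatisfiesLDP P Y v I where
  nonneg := hI
  lowerSemicontinuous := hI_lsc
  lower_bound B _ := by
    rw [EReal.neg_le]
    refine le_iInf₂ fun x hx => ?_
    rw [EReal.neg_le]
    refine EReal.ge_of_forall_gt_iff_ge.mp fun b hb => ?_
    have hc : I x < ((-b : ℝ) : EReal) := by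
      rw [EReal.coe_neg]
      exact EReal.lt_neg_comm.mp hb
    refine le_liminf_of_le (by isBoundedDefault) ?_
    filter_upwards [hv, h_lower _ isOpen_interior x hx (-b) hc] with n hn h
    rw [neg_neg] at h
    rw [EReal.le_div_iff_mul_le (by exact_mod_cast hn) (EReal.coe_ne_top _), ← EReal.coe_mul,
      ← log_ofReal_exp]
    refine ENNReal.log_le_log ((ENNReal.ofReal_le_ofReal h).trans ?_)
    rw [ofReal_measureReal]
    exact measure_mono fun ω hω => interior_subset (s := B) hω
  upper_bound B _ := by
    refine EReal.le_of_forall_lt_iff_le.mp fun b hb => ?_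
    have hc : ((-b : ℝ) : EReal) < ⨅ x ∈ closure B, I x := by
      rw [EReal.coe_neg]
      exact EReal.neg_lt_comm.mp hb
    refine limsup_le_of_le (by isBoundedDefault) ?_
    filter_upwards [hv, h_upper _ isClosed_closure (-b) hc] with n hn h
    rw [neg_neg] at h
    rw [EReal.div_le_iff_le_mul (by exact_mod_cast hn) (EReal.coe_ne_top _), mul_comm,
      ← EReal.coe_mul, ← log_ofReal_exp]
    refine ENNReal.log_le_log (le_trans ?_ (ENNReal.ofReal_le_ofReal h))
    rw [ofReal_measureReal]
    exact measure_mono fun ω hω => subset_closure (s := B) hω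

theorem legendreTransform_nonneg {Λ : ℝ → EReal} (h : Λ 0 = 0) (x : ℝ) :
    0 ≤ legendreTransform Λ x := by
  refine le_trans ?_ (le_iSup _ (0 : ℝ))
  simp [h]

theorem continuous_mul_sub_coe (η : ℝ) {l : EReal} (hl : l ≠ ⊥) :
    Continuous fun x : ℝ => ((η * x : ℝ) : EReal) - l := by
  induction l using EReal.rec with
  | bot => exact absurd rfl hl
  | top => simpa using continuous_const
  | coe r =>
    simp_rw [← EReal.coe_sub]
    exact continuous_coe_real_ereal.comp (by fun_prop)

theorem lowerSemicontinuous_legendreTransform {Λ : ℝ → EReal} (h : ∀ η, Λ η ≠ ⊥) :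
    LowerSemicontinuous (legendreTransform Λ) :=
  lowerSemicontinuous_iSup fun η => (continuous_mul_sub_coe η (h η)).lowerSemicontinuous

end LargeDeviations

section ExponentialMoments

open Set

/-- The moment generating function `t ↦ ∫ exp (t x) dμ(x)` of a measure on the line, valued in
`[0, ∞]` rather than in `ℝ`, so that a divergent integral has the value `∞` and not the default
value `0` of `mgf id μ`. -/
noncomputable def expMoment (μ : Measure ℝ) (t : ℝ) : ℝ≥0∞ :=
  ∫⁻ x, ENNReal.ofReal (Real.exp (t * x)) ∂μ

variable {Ω : Type*} [MeasurableSpace Ω] {P : Measure Ω} {μ : Measure ℝ}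

theorem expMoment_map {Y : Ω → ℝ} (hY : AEMeasurable Y P) (t : ℝ) :
    expMoment (P.map Y) t = ∫⁻ ω, ENNReal.ofReal (Real.exp (t * Y ω)) ∂P :=
  lintegral_map' (by fun_prop) hY

theorem freeEnergy_eq_log_expMoment {Y : Ω → ℝ} (hY : HasLaw Y μ P) (t : ℝ) :
    freeEnergy P Y t = ENNReal.log (expMoment μ t) := by
  rw [freeEnergy, ← expMoment_map hY.aemeasurable, hY.map_eq]

theorem expMoment_zero (μ : Measure ℝ) [IsProbabilityMeasure μ] : expMoment μ 0 = 1 := by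
  simp [expMoment]

theorem expMoment_ne_zero (μ : Measure ℝ) [NeZero μ] (t : ℝ) : expMoment μ t ≠ 0 := by
  rw [expMoment, Ne, lintegral_eq_zero_iff (by fun_prop)]
  intro h
  obtain ⟨x, hx⟩ := h.exists
  exact (ENNReal.ofReal_pos.mpr (Real.exp_pos (t * x))).ne' hx

theorem ofReal_mgf {t : ℝ} (h : Integrable (fun x => Real.exp (t * x)) μ) :
    ENNReal.ofReal (mgf id μ t) = expMoment μ t :=
  ofReal_integral_eq_lintegral_ofReal h (ae_of_all _ fun _ => (Real.exp_pos _).le)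

theorem expMoment_map_sub_const (μ : Measure ℝ) (x t : ℝ) :
    expMoment (μ.map (· - x)) t = ENNReal.ofReal (Real.exp (-(t * x))) * expMoment μ t := by
  rw [expMoment_map (by fun_prop), expMoment, ← lintegral_const_mul _ (by fun_prop)]
  refine lintegral_congr fun y => ?_
  rw [← ENNReal.ofReal_mul (Real.exp_pos _).le, ← Real.exp_add]
  ring_nf

theorem measure_le_mul_le_exp_mul_expMoment (μ : Measure ℝ) (t a : ℝ) :
    μ {x | a ≤ t * x} ≤ ENNReal.ofReal (Real.exp (-a)) * expMoment μ t := by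
  rw [expMoment, ← lintegral_const_mul _ (by fun_prop), ← lintegral_indicator_one
    (measurableSet_le measurable_const (by fun_prop))]
  refine lintegral_mono fun x => indicator_apply_le' (fun hx => ?_) fun _ => zero_le
  rw [← ENNReal.ofReal_mul (Real.exp_pos _).le, ← Real.exp_add, Pi.one_apply, ENNReal.one_le_ofReal,
    Real.one_le_exp_iff]
  have : a ≤ t * x := hx
  linarith

theorem expMoment_le_ball_add (μ : Measure ℝ) {h : ℝ} (hh : 0 ≤ h) (η r : ℝ) :
    expMoment μ η ≤ ENNReal.ofReal (Real.exp (|η| * r)) * μ {x | |x| < r} +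
      ENNReal.ofReal (Real.exp (-(h * r))) * (expMoment μ (η + h) + expMoment μ (η - h)) := by
  have hball : MeasurableSet {x : ℝ | |x| < r} := measurableSet_lt (by fun_prop) measurable_const
  rw [expMoment, expMoment, expMoment, ← lintegral_indicator_const hball,
    ← lintegral_add_left (by fun_prop), ← lintegral_const_mul _ (by fun_prop),
    ← lintegral_add_left (measurable_const.indicator hball)]
  refine lintegral_mono fun x => ?_
  by_cases hx : |x| < r
  · have hexp : η * x ≤ |η| * r :=
      calc η * x ≤ |η| * |x| := (le_abs_self _).trans (abs_mul η x).le
        _ ≤ |η| * r := by gcongr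
    rw [indicator_of_mem (s := {x | |x| < r}) hx]
    exact le_add_right (ENNReal.ofReal_le_ofReal (Real.exp_le_exp.mpr hexp))
  · rw [indicator_of_notMem (s := {x | |x| < r}) hx, zero_add, mul_add,
      ← ENNReal.ofReal_mul (Real.exp_pos _).le, ← ENNReal.ofReal_mul (Real.exp_pos _).le,
      ← Real.exp_add, ← Real.exp_add]
    rcases le_abs.mp (not_lt.mp hx) with hrx | hrx
    · exact le_add_right (ENNReal.ofReal_le_ofReal (Real.exp_le_exp.mpr (by nlinarith)))
    · exact le_add_left (ENNReal.ofReal_le_ofReal (Real.exp_le_exp.mpr (by nlinarith)))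

variable {X : ℕ → Ω → ℝ}

theorem lintegral_prod_range_comp (hX : iIndepFun X P) (hlaw : ∀ i, HasLaw (X i) μ P)
    {g : ℝ → ℝ≥0∞} (hg : Measurable g) (n : ℕ) :
    ∫⁻ ω, ∏ i ∈ Finset.range n, g (X i ω) ∂P = (∫⁻ x, g x ∂μ) ^ n := by
  let X' : ℕ → Ω → ℝ := fun i => (hlaw i).aemeasurable.mk
  have hXX' : ∀ i, X i =ᵐ[P] X' i := fun i => (hlaw i).aemeasurable.ae_eq_mk
  have hX' : ∀ i, Measurable (X' i) := fun i => (hlaw i).aemeasurable.measurable_mk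
  calc ∫⁻ ω, ∏ i ∈ Finset.range n, g (X i ω) ∂P
      = ∫⁻ ω, ∏ i ∈ Finset.range n, g (X' i ω) ∂P := by
        refine lintegral_congr_ae ?_
        filter_upwards [ae_all_iff.mpr hXX'] with ω hω
        simp_rw [hω]
    _ = ∏ i ∈ Finset.range n, ∫⁻ ω, g (X' i ω) ∂P :=
        lintegral_prod_eq_prod_lintegral_of_indepFun _ _
          ((hX.congr hXX').comp (fun _ => g) fun _ => hg) fun i => hg.comp (hX' i)
    _ = ∏ _i ∈ Finset.range n, ∫⁻ x, g x ∂μ :=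
        Finset.prod_congr rfl fun i _ =>
          ((hlaw i).congr (hXX' i).symm).lintegral_comp hg.aemeasurable
    _ = (∫⁻ x, g x ∂μ) ^ n := by rw [Finset.prod_const, Finset.card_range]

theorem aemeasurable_sum_range (hlaw : ∀ i, HasLaw (X i) μ P) (n : ℕ) :
    AEMeasurable (fun ω => ∑ i ∈ Finset.range n, X i ω) P :=
  Finset.aemeasurable_fun_sum _ fun i _ => (hlaw i).aemeasurable

theorem expMoment_map_sum_restrict (hX : iIndepFun X P) (hlaw : ∀ i, HasLaw (X i) μ P)
    {A : Set ℝ} (hA : MeasurableSet A) (t : ℝ) (n : ℕ) :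
    expMoment ((P.restrict {ω | ∀ i ∈ Finset.range n, X i ω ∈ A}).map
      fun ω => ∑ i ∈ Finset.range n, X i ω) t = expMoment (μ.restrict A) t ^ n := by
  have hAn : NullMeasurableSet {ω | ∀ i ∈ Finset.range n, X i ω ∈ A} P := by
    simp_rw [ofPred_forall]
    exact .biInter (Finset.range n).countable_toSet fun i _ =>
      (hlaw i).aemeasurable.nullMeasurableSet_preimage hA
  rw [expMoment_map (aemeasurable_sum_range hlaw n).restrict, expMoment,
    ← lintegral_indicator hA, ← lintegral_indicator₀ hAn,
    ← lintegral_prod_range_comp hX hlaw (Measurable.indicator (by fun_prop) hA)]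
  refine lintegral_congr fun ω => ?_
  by_cases hω : ∀ i ∈ Finset.range n, X i ω ∈ A
  · rw [indicator_of_mem (mem_ofPred.mpr hω), Finset.mul_sum, Real.exp_sum,
      ENNReal.ofReal_prod_of_nonneg fun _ _ => (Real.exp_pos _).le]
    exact Finset.prod_congr rfl fun i hi => by rw [indicator_of_mem (hω i hi)]
  · rw [indicator_of_notMem (s := {ω | ∀ i ∈ Finset.range n, X i ω ∈ A}) hω]
    push Not at hω
    obtain ⟨i, hi, hiA⟩ := hω
    exact (Finset.prod_eq_zero hi (indicator_of_notMem hiA _)).symm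

theorem expMoment_map_sum (hX : iIndepFun X P) (hlaw : ∀ i, HasLaw (X i) μ P) (t : ℝ) (n : ℕ) :
    expMoment (P.map fun ω => ∑ i ∈ Finset.range n, X i ω) t = expMoment μ t ^ n := by
  simpa using expMoment_map_sum_restrict hX hlaw MeasurableSet.univ t n

end ExponentialMoments

section CramerUpperBound

open Set

theorem measure_le_of_forall_measure_ge_le {E : Type*} [TopologicalSpace E] [MeasurableSpace E]
    {μ : Measure E} [μ.InnerRegularCompactLTTop] [IsFiniteMeasure μ] {A : Set E}
    (hA : MeasurableSet A) {f : E → ℝ} (hf : Continuous f) {r : ℝ≥0∞}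
    (h : ∀ x ∈ A, μ {y | f x ≤ f y} ≤ r) : μ A ≤ r := by
  rw [hA.measure_eq_iSup_isCompact_of_ne_top (measure_ne_top μ A)]
  refine iSup₂_le fun K hKA => iSup_le fun hK => ?_
  rcases K.eq_empty_or_nonempty with rfl | hK'
  · simp
  · obtain ⟨x, hxK, hx⟩ := hK.exists_isMinOn hK' hf.continuousOn
    exact (measure_mono fun y hy => hx hy).trans (h x (hKA hxK))

theorem measure_lt_legendreTransform_le {ν : Measure ℝ} [IsFiniteMeasure ν] {Λ : ℝ → EReal}
    (hΛ : ∀ t, Λ t ≠ ⊥) {d : EReal} {r : ℝ≥0∞}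
    (h : ∀ t x : ℝ, d < ((t * x : ℝ) : EReal) - Λ t → ν {y | t * x ≤ t * y} ≤ r) :
    ν {x | d < legendreTransform Λ x} ≤ 2 * r := by
  let halfSpaces (T : Set ℝ) : Set ℝ := ⋃ t ∈ T, {x | d < ((t * x : ℝ) : EReal) - Λ t}
  have hmeas : ∀ T, MeasurableSet (halfSpaces T) := fun T =>
    (isOpen_biUnion fun t _ =>
      isOpen_Ioi.preimage (continuous_mul_sub_coe t (hΛ t))).measurableSet
  have hcover : {x | d < legendreTransform Λ x} ⊆ halfSpaces (Ici 0) ∪ halfSpaces (Iic 0) := by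
    intro x hx
    obtain ⟨t, ht⟩ := lt_iSup_iff.mp (mem_ofPred.mp hx)
    exact (le_total 0 t).imp (fun h0 => mem_biUnion h0 ht) fun h0 => mem_biUnion h0 ht
  have hpos : ν (halfSpaces (Ici 0)) ≤ r := by
    refine measure_le_of_forall_measure_ge_le (hmeas _) continuous_id fun x hx => ?_
    obtain ⟨t, ht, hx⟩ := mem_iUnion₂.mp hx
    exact (h t x hx).trans' (measure_mono fun y hy => mem_ofPred.mpr <|
      mul_le_mul_of_nonneg_left (mem_ofPred.mp hy) ht)
  have hneg : ν (halfSpaces (Iic 0)) ≤ r := by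
    refine measure_le_of_forall_measure_ge_le (hmeas _) continuous_neg fun x hx => ?_
    obtain ⟨t, ht, hx⟩ := mem_iUnion₂.mp hx
    exact (h t x hx).trans' (measure_mono fun y hy => mem_ofPred.mpr <|
      mul_le_mul_of_nonpos_left (neg_le_neg_iff.mp (mem_ofPred.mp hy)) ht)
  calc ν {x | d < legendreTransform Λ x}
      ≤ ν (halfSpaces (Ici 0)) + ν (halfSpaces (Iic 0)) :=
        (measure_mono hcover).trans (measure_union_le _ _)
    _ ≤ 2 * r := by rw [two_mul]; gcongr

theorem expMoment_lt_of_lt_sub_log {μ : Measure ℝ} {t a d : ℝ}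
    (h : (d : EReal) < (a : EReal) - ENNReal.log (expMoment μ t)) :
    expMoment μ t < ENNReal.ofReal (Real.exp (a - d)) := by
  rw [← ENNReal.log_lt_log_iff, log_ofReal_exp]
  induction hl : ENNReal.log (expMoment μ t) using EReal.rec with
  | bot => exact EReal.bot_lt_coe _
  | top => simp [hl] at h
  | coe l =>
    rw [hl] at h
    norm_cast at h ⊢
    linarith

theorem lt_expMoment_of_sub_log_lt {μ : Measure ℝ} {t a c : ℝ}
    (h : (a : EReal) - ENNReal.log (expMoment μ t) < c) :
    ENNReal.ofReal (Real.exp (a - c)) < expMoment μ t := by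
  rw [← ENNReal.log_lt_log_iff, log_ofReal_exp]
  induction hl : ENNReal.log (expMoment μ t) using EReal.rec with
  | bot => simp [hl] at h
  | top => exact EReal.coe_lt_top _
  | coe l =>
    rw [hl] at h
    norm_cast at h ⊢
    linarith

theorem natCast_mul_empiricalMean {Ω : Type*} (X : ℕ → Ω → ℝ) (n : ℕ) (ω : Ω) :
    n * empiricalMean X n ω = ∑ i ∈ Finset.range n, X i ω := by
  rcases n.eq_zero_or_pos with rfl | hn
  · simp
  · rw [empiricalMean]
    field_simp

variable {Ω : Type*} [MeasurableSpace Ω] {P : Measure Ω} {μ : Measure ℝ} {X : ℕ → Ω → ℝ}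

theorem aemeasurable_empiricalMean (hlaw : ∀ i, HasLaw (X i) μ P) (n : ℕ) :
    AEMeasurable (empiricalMean X n) P :=
  (aemeasurable_sum_range hlaw n).const_mul _

theorem measure_mul_le_mul_empiricalMean_le (hX : iIndepFun X P) (hlaw : ∀ i, HasLaw (X i) μ P)
    {t x d : ℝ} (h : (d : EReal) < ((t * x : ℝ) : EReal) - ENNReal.log (expMoment μ t)) (n : ℕ) :
    P {ω | t * x ≤ t * empiricalMean X n ω} ≤ ENNReal.ofReal (Real.exp (-d * n)) := by
  have hset : {ω | t * x ≤ t * empiricalMean X n ω} ⊆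
      (fun ω => ∑ i ∈ Finset.range n, X i ω) ⁻¹' {s | n * (t * x) ≤ t * s} := by
    intro ω hω
    have : n * (t * x) ≤ n * (t * empiricalMean X n ω) := mul_le_mul_of_nonneg_left hω n.cast_nonneg
    rwa [mul_left_comm (n : ℝ) t (empiricalMean X n ω), natCast_mul_empiricalMean] at this
  calc P {ω | t * x ≤ t * empiricalMean X n ω}
      ≤ P.map (fun ω => ∑ i ∈ Finset.range n, X i ω) {s | n * (t * x) ≤ t * s} := by
        rw [Measure.map_apply_of_aemeasurable (aemeasurable_sum_range hlaw n)
          (measurableSet_le measurable_const (by fun_prop))]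
        exact measure_mono hset
    _ ≤ ENNReal.ofReal (Real.exp (-(n * (t * x)))) * expMoment μ t ^ n := by
        rw [← expMoment_map_sum hX hlaw]
        exact measure_le_mul_le_exp_mul_expMoment _ _ _
    _ ≤ ENNReal.ofReal (Real.exp (-(n * (t * x)))) *
          ENNReal.ofReal (Real.exp (t * x - d)) ^ n := by
        gcongr
        exact (expMoment_lt_of_lt_sub_log h).le
    _ = ENNReal.ofReal (Real.exp (-d * n)) := by
        rw [← ENNReal.ofReal_pow (Real.exp_pos _).le, ← Real.exp_nat_mul,
          ← ENNReal.ofReal_mul (Real.exp_pos _).le, ← Real.exp_add]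
        ring_nf

theorem log_expMoment_ne_bot (μ : Measure ℝ) [NeZero μ] (t : ℝ) :
    ENNReal.log (expMoment μ t) ≠ ⊥ :=
  ENNReal.log_eq_bot_iff.not.mpr (expMoment_ne_zero μ t)

theorem eventually_measureReal_empiricalMean_mem_le [IsProbabilityMeasure μ] (hX : iIndepFun X P)
    (hlaw : ∀ i, HasLaw (X i) μ P) {F : Set ℝ} {c : ℝ}
    (hc : (c : EReal) < ⨅ x ∈ F, legendreTransform (fun t => ENNReal.log (expMoment μ t)) x) :
    ∀ᶠ n : ℕ in atTop, P.real {ω | empiricalMean X n ω ∈ F} ≤ Real.exp (-c * n) := by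
  have := (hlaw 0).isProbabilityMeasure
  obtain ⟨d, hcd, hdF⟩ := EReal.lt_iff_exists_real_btwn.mp hc
  filter_upwards [eventually_mul_exp_le_exp (K := 2) (EReal.coe_lt_coe_iff.mp hcd)
    tendsto_natCast_atTop_atTop] with n hn
  refine le_trans ?_ hn
  have hmean := aemeasurable_empiricalMean hlaw n
  have hF : F ⊆ {x | d < legendreTransform (fun t => ENNReal.log (expMoment μ t)) x} :=
    fun x hx => hdF.trans_le (iInf₂_le x hx)
  have htail (t x : ℝ) (h : (d : EReal) < ((t * x : ℝ) : EReal) - ENNReal.log (expMoment μ t)) :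
      P.map (empiricalMean X n) {y | t * x ≤ t * y} ≤ ENNReal.ofReal (Real.exp (-d * n)) := by
    rw [Measure.map_apply_of_aemeasurable hmean (measurableSet_le measurable_const (by fun_prop))]
    exact measure_mul_le_mul_empiricalMean_le hX hlaw h n
  refine ENNReal.toReal_le_of_le_ofReal (by positivity) ?_
  rw [ENNReal.ofReal_mul zero_le_two, ENNReal.ofReal_ofNat]
  exact (Measure.le_map_apply hmean F).trans <| (measure_mono hF).trans <|
    measure_lt_legendreTransform_le (log_expMoment_ne_bot μ) htail

end CramerUpperBound

section CramerLowerBound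

open Set

theorem eventually_mul_exp_neg_lt_of_hasDerivAt_zero {f : ℝ → ℝ} {η δ : ℝ}
    (hf : HasDerivAt f 0 η) (hη : 0 < f η) (hδ : 0 < δ) :
    ∀ᶠ h in 𝓝[>] 0, f (η + h) * Real.exp (-(h * δ)) < f η ∧
      f (η - h) * Real.exp (-(h * δ)) < f η := by
  have hsmall := (hasDerivAt_iff_isLittleO_nhds_zero.mp hf).bound (by positivity : 0 < f η * δ / 2)
  have hsmall_neg := (continuous_neg.tendsto' (0 : ℝ) 0 neg_zero).eventually hsmall
  filter_upwards [nhdsWithin_le_nhds hsmall, nhdsWithin_le_nhds hsmall_neg, self_mem_nhdsWithin]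
    with h hplus hminus (hh : 0 < h)
  have key {y : ℝ} (hy : |y - f η| ≤ f η * δ / 2 * h) : y * Real.exp (-(h * δ)) < f η := by
    rw [Real.exp_neg, ← div_eq_mul_inv, div_lt_iff₀ (Real.exp_pos _)]
    have hexp := mul_le_mul_of_nonneg_left (Real.add_one_le_exp (h * δ)) hη.le
    have : 0 < f η * δ * h := by positivity
    linarith [le_abs_self (y - f η)]
  simp only [smul_zero, sub_zero, Real.norm_eq_abs, abs_neg, abs_of_pos hh,
    ← sub_eq_add_neg] at hplus hminus
  exact ⟨key hplus, key hminus⟩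

theorem eventually_add_pow_le_pow {a b c m : ℝ} (ha : 0 ≤ a) (hb : 0 ≤ b) (hc : 0 ≤ c)
    (ham : a < m) (hbm : b < m) (hcm : c < m) :
    ∀ᶠ n : ℕ in atTop, a ^ n + b ^ n + c ^ n ≤ m ^ n := by
  have ho := ((isLittleO_pow_pow_of_lt_left ha ham).add
    (isLittleO_pow_pow_of_lt_left hb hbm)).add (isLittleO_pow_pow_of_lt_left hc hcm)
  filter_upwards [ho.bound one_pos] with n hn
  rw [one_mul, Real.norm_of_nonneg (pow_nonneg (ha.trans ham.le) n)] at hn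
  exact (le_abs_self _).trans hn

variable {Ω : Type*} [MeasurableSpace Ω] {P : Measure Ω} {μ : Measure ℝ} {X : ℕ → Ω → ℝ}

theorem mgf_restrict_pow_le [IsProbabilityMeasure μ] (hX : iIndepFun X P)
    (hlaw : ∀ i, HasLaw (X i) μ P) {A : Set ℝ} (hA : MeasurableSet A)
    (hint : ∀ t, Integrable (fun x => Real.exp (t * x)) (μ.restrict A)) (η δ : ℝ) {h : ℝ}
    (hh : 0 ≤ h) (n : ℕ) :
    mgf id (μ.restrict A) η ^ n ≤
      Real.exp (|η| * δ) ^ n * P.real {ω | |∑ i ∈ Finset.range n, X i ω| < n * δ} +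
        ((mgf id (μ.restrict A) (η + h) * Real.exp (-(h * δ))) ^ n +
          (mgf id (μ.restrict A) (η - h) * Real.exp (-(h * δ))) ^ n) := by
  have := (hlaw 0).isProbabilityMeasure
  have hball : MeasurableSet {x : ℝ | |x| < n * δ} :=
    measurableSet_lt (by fun_prop) measurable_const
  have hP : (P.restrict {ω | ∀ i ∈ Finset.range n, X i ω ∈ A}).map
      (fun ω => ∑ i ∈ Finset.range n, X i ω) {x | |x| < n * δ} ≤
      ENNReal.ofReal (P.real {ω | |∑ i ∈ Finset.range n, X i ω| < n * δ}) := by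
    rw [Measure.map_apply_of_aemeasurable (aemeasurable_sum_range hlaw n).restrict hball,
      ofReal_measureReal]
    exact Measure.restrict_apply_le _ _
  have htilt := expMoment_le_ball_add ((P.restrict {ω | ∀ i ∈ Finset.range n, X i ω ∈ A}).map
    fun ω => ∑ i ∈ Finset.range n, X i ω) hh η (n * δ)
  simp only [expMoment_map_sum_restrict hX hlaw hA, ← ofReal_mgf (hint _)] at htilt
  have hm : ∀ t, 0 ≤ mgf id (μ.restrict A) t := fun t => mgf_nonneg
  have hexp : ∀ s : ℝ, Real.exp (s * (n * δ)) = Real.exp (s * δ) ^ n := fun s => by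
    rw [← Real.exp_nat_mul]
    ring_nf
  rw [← neg_mul, hexp, hexp] at htilt
  have hplus := hm (η + h)
  have hminus := hm (η - h)
  have hη := hm η
  rw [← ENNReal.ofReal_pow hη, ← ENNReal.ofReal_pow hplus, ← ENNReal.ofReal_pow hminus,
    ← ENNReal.ofReal_add (by positivity) (by positivity), ← ENNReal.ofReal_mul (by positivity)]
    at htilt
  refine (ENNReal.ofReal_le_ofReal_iff (by positivity)).mp (htilt.trans ?_)
  rw [ENNReal.ofReal_add (by positivity) (by positivity),
    ENNReal.ofReal_mul (pow_nonneg (Real.exp_pos (|η| * δ)).le n), mul_pow, mul_pow,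
    ← add_mul, mul_comm (_ + _), ← neg_mul]
  exact add_le_add_left (mul_le_mul_right hP _) _

theorem eventually_le_measureReal_abs_sum_lt [IsProbabilityMeasure μ] (hX : iIndepFun X P)
    (hlaw : ∀ i, HasLaw (X i) μ P) {A : Set ℝ} (hA : MeasurableSet A)
    (hint : ∀ t, Integrable (fun x => Real.exp (t * x)) (μ.restrict A)) {η : ℝ}
    (hη : HasDerivAt (mgf id (μ.restrict A)) 0 η) {c δ : ℝ}
    (hc : Real.exp (-c) < mgf id (μ.restrict A) η) (hδ : 0 < δ) :
    ∀ᶠ n : ℕ in atTop,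
      Real.exp (-c * n) ≤ P.real {ω | |∑ i ∈ Finset.range n, X i ω| < n * δ} := by
  have := (hlaw 0).isProbabilityMeasure
  set m := mgf id (μ.restrict A)
  obtain ⟨δ', ⟨hδ', hδδ'⟩, hslack⟩ : ∃ δ' ∈ Ioc 0 δ, Real.exp (-c) * Real.exp (|η| * δ') < m η := by
    have hlim : Tendsto (fun d : ℝ => Real.exp (-c) * Real.exp (|η| * d)) (𝓝[>] 0)
        (𝓝 (Real.exp (-c) * Real.exp (|η| * 0))) :=
      (Continuous.tendsto (by fun_prop) 0).mono_left nhdsWithin_le_nhds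
    have hev := hlim.eventually_lt_const (u := m η) (by simpa using hc)
    exact (Filter.Eventually.and (Ioc_mem_nhdsGT hδ) hev).exists
  obtain ⟨h, (hh : 0 < h), hplus, hminus⟩ : ∃ h ∈ Ioi 0, m (η + h) * Real.exp (-(h * δ')) < m η ∧
      m (η - h) * Real.exp (-(h * δ')) < m η := by
    have hev := eventually_mul_exp_neg_lt_of_hasDerivAt_zero hη ((Real.exp_pos _).trans hc) hδ'
    exact (eventually_mem_nhdsWithin.and hev).exists
  filter_upwards [eventually_add_pow_le_pow (by positivity)
    (mul_nonneg mgf_nonneg (Real.exp_pos _).le) (mul_nonneg mgf_nonneg (Real.exp_pos _).le)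
    hslack hplus hminus] with n hn
  have hmono : P.real {ω | |∑ i ∈ Finset.range n, X i ω| < n * δ'} ≤
      P.real {ω | |∑ i ∈ Finset.range n, X i ω| < n * δ} :=
    measureReal_mono fun ω hω => mem_ofPred.mpr ((mem_ofPred.mp hω).trans_le (by gcongr))
  refine le_trans (le_of_mul_le_mul_left ?_ (pow_pos (Real.exp_pos (|η| * δ')) n)) hmono
  have hmain := mgf_restrict_pow_le hX hlaw hA hint η δ' hh.le n
  calc Real.exp (|η| * δ') ^ n * Real.exp (-c * n)
      = (Real.exp (-c) * Real.exp (|η| * δ')) ^ n := by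
        rw [mul_pow, ← Real.exp_nat_mul (-c), mul_comm, mul_comm (n : ℝ) (-c)]
    _ ≤ _ := by linarith

end CramerLowerBound

section TruncatedTilt

open Set Metric

variable {μ ν : Measure ℝ}

theorem integrable_exp_mul_restrict_closedBall (μ : Measure ℝ) [IsFiniteMeasure μ] (K t : ℝ) :
    Integrable (fun x => Real.exp (t * x)) (μ.restrict (closedBall 0 K)) := by
  refine integrable_exp_mul_of_mem_Icc (a := 0 - K) (b := 0 + K) (X := id) aemeasurable_id ?_
  rw [← Real.closedBall_eq_Icc]
  exact ae_restrict_mem measurableSet_closedBall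

theorem monotone_restrict_closedBall (μ : Measure ℝ) :
    Monotone fun K : ℕ => μ.restrict (closedBall 0 (K : ℝ)) := fun _ _ hKL =>
  Measure.restrict_mono_set μ (closedBall_subset_closedBall (Nat.cast_le.mpr hKL))

theorem iSup_expMoment_restrict_closedBall (μ : Measure ℝ) (t : ℝ) :
    ⨆ K : ℕ, expMoment (μ.restrict (closedBall 0 K)) t = expMoment μ t := by
  have hdir : Directed (· ⊆ ·) fun K : ℕ => closedBall (0 : ℝ) K :=
    Monotone.directed_le fun _ _ hKL => closedBall_subset_closedBall (Nat.cast_le.mpr hKL)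
  simp only [expMoment]
  rw [← setLIntegral_iUnion_of_directed _ hdir, iUnion_closedBall_nat, setLIntegral_univ]

theorem exists_forall_ge_restrict_closedBall_ne_zero {A : Set ℝ} (hA : μ A ≠ 0) :
    ∃ K : ℕ, ∀ L ≥ K, μ.restrict (closedBall 0 (L : ℝ)) A ≠ 0 := by
  have hcover : μ (⋃ K : ℕ, A ∩ closedBall 0 (K : ℝ)) ≠ 0 := by
    rwa [← inter_iUnion, iUnion_closedBall_nat, inter_univ]
  obtain ⟨K, hK⟩ := exists_measure_pos_of_not_measure_iUnion_null hcover
  rw [← Measure.restrict_apply' measurableSet_closedBall] at hK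
  exact ⟨K, fun L hL => (hK.trans_le (monotone_restrict_closedBall μ hL A)).ne'⟩

theorem tendsto_mgf_id_atTop [IsFiniteMeasure ν]
    (hint : ∀ t, Integrable (fun x => Real.exp (t * x)) ν) (hpos : ν (Ioi 0) ≠ 0) :
    Tendsto (mgf id ν) atTop atTop := by
  obtain ⟨ε, hε, hεν⟩ : ∃ ε ∈ Ioi (0 : ℝ), ν (Ici ε) ≠ 0 := by
    by_contra! hzero
    exact hpos (le_zero_iff.mp (measure_le_of_forall_measure_ge_le measurableSet_Ioi continuous_id
      fun x hx => (hzero x hx).le))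
  have hexp : Tendsto (fun t => ν.real (Ici ε) * Real.exp (t * ε)) atTop atTop :=
    (Real.tendsto_exp_atTop.comp (tendsto_id.atTop_mul_const hε)).const_mul_atTop
      (ENNReal.toReal_pos hεν (measure_ne_top ν _))
  refine tendsto_atTop_mono' _ ?_ hexp
  filter_upwards [eventually_ge_atTop 0] with t ht
  have hchernoff := measure_ge_le_exp_mul_mgf (X := id) ε ht (hint t)
  rwa [neg_mul, Real.exp_neg, inv_mul_eq_div, le_div_iff₀ (Real.exp_pos _)] at hchernoff

theorem tendsto_mgf_id_cocompact [IsFiniteMeasure ν]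
    (hint : ∀ t, Integrable (fun x => Real.exp (t * x)) ν) (hpos : ν (Ioi 0) ≠ 0)
    (hneg : ν (Iio 0) ≠ 0) : Tendsto (mgf id ν) (cocompact ℝ) atTop := by
  rw [cocompact_eq_atBot_atTop]
  refine Tendsto.sup ?_ (tendsto_mgf_id_atTop hint hpos)
  have hreflect : mgf id ν = mgf id (ν.map (-·)) ∘ (-·) := by
    ext t
    rw [Function.comp_apply, mgf_id_map (by fun_prop)]
    simp [mgf]
  rw [hreflect]
  refine (tendsto_mgf_id_atTop (fun t => ?_) ?_).comp tendsto_neg_atBot_atTop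
  · rw [integrable_map_measure (by fun_prop) (by fun_prop)]
    simpa [Function.comp_def] using hint (-t)
  · rwa [Measure.map_apply measurable_neg measurableSet_Ioi, neg_preimage, neg_Ioi, neg_zero]

theorem exists_hasDerivAt_mgf_zero (hint : ∀ t, Integrable (fun x => Real.exp (t * x)) ν)
    (hlim : Tendsto (mgf id ν) (cocompact ℝ) atTop) : ∃ η, HasDerivAt (mgf id ν) 0 η := by
  have hset : integrableExpSet id ν = univ := eq_univ_of_forall hint
  obtain ⟨η, hη⟩ := (continuous_mgf hint).exists_forall_le hlim
  have hderiv := hasDerivAt_mgf (X := id) (μ := ν) (t := η) (by simp [hset])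
  refine ⟨η, ?_⟩
  rwa [IsLocalMin.hasDerivAt_eq_zero (Eventually.of_forall hη) hderiv] at hderiv

theorem exists_forall_lt_mgf_restrict_closedBall [IsFiniteMeasure μ] (hpos : μ (Ioi 0) ≠ 0)
    (hneg : μ (Iio 0) ≠ 0) {r : ℝ} (hr : ENNReal.ofReal r < ⨅ t, expMoment μ t) :
    ∃ K : ℕ, Tendsto (mgf id (μ.restrict (closedBall 0 K))) (cocompact ℝ) atTop ∧
      ∀ t, r < mgf id (μ.restrict (closedBall 0 K)) t := by
  obtain ⟨K₁, hK₁⟩ := exists_forall_ge_restrict_closedBall_ne_zero hpos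
  obtain ⟨K₂, hK₂⟩ := exists_forall_ge_restrict_closedBall_ne_zero hneg
  set K := max K₁ K₂
  set m : ℕ → ℝ → ℝ := fun L => mgf id (μ.restrict (closedBall 0 (L : ℝ)))
  have hint (L : ℕ) := integrable_exp_mul_restrict_closedBall μ L
  have hlim (L : ℕ) (hL : K ≤ L) : Tendsto (m L) (cocompact ℝ) atTop :=
    tendsto_mgf_id_cocompact (hint L) (hK₁ L (le_of_max_le_left hL)) (hK₂ L (le_of_max_le_right hL))
  have hmono (t : ℝ) : Monotone fun L => m L t := fun L M hLM =>
    integral_mono_measure (monotone_restrict_closedBall μ hLM)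
      (ae_of_all _ fun _ => (Real.exp_pos _).le) (hint M t)
  have hclosed (L : ℕ) : IsClosed {t | m L t ≤ r} :=
    isClosed_le (continuous_mgf (hint L)) continuous_const
  by_contra! hsmall
  obtain ⟨t, ht⟩ : (⋂ j : ℕ, {t | m (K + j) t ≤ r}).Nonempty := by
    refine IsCompact.nonempty_iInter_of_sequence_nonempty_isCompact_isClosed _
      (fun j t ht => (hmono t (by lia)).trans ht) (fun j => hsmall _ (hlim _ (by lia))) ?_
      fun j => hclosed _
    obtain ⟨C, hC, hCsub⟩ := mem_cocompact'.mp ((hlim K le_rfl).eventually_gt_atTop r)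
    exact hC.of_isClosed_subset (hclosed K) fun t ht => hCsub (not_lt.mpr (mem_ofPred.mp ht))
  refine hr.not_ge ((iInf_le _ t).trans ?_)
  rw [← iSup_expMoment_restrict_closedBall]
  refine iSup_le fun L => ?_
  rw [← ofReal_mgf (hint L t)]
  exact ENNReal.ofReal_le_ofReal ((hmono t (by lia : L ≤ K + L)).trans (mem_iInter.mp ht L))

theorem iInf_expMoment_le_of_Ioi_eq_zero [IsFiniteMeasure μ] (h : μ (Ioi 0) = 0) :
    ⨅ t, expMoment μ t ≤ μ {0} := by
  have hnonpos : ∀ᵐ x ∂μ, x ≤ 0 := by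
    filter_upwards [compl_mem_ae_iff.mpr h] with x hx using not_lt.mp hx
  have hlim : Tendsto (fun n : ℕ => expMoment μ n) atTop
      (𝓝 (∫⁻ x, ({0} : Set ℝ).indicator 1 x ∂μ)) := by
    refine tendsto_lintegral_of_dominated_convergence 1 (fun n => by fun_prop) (fun n => ?_)
      (by simp) ?_
    · filter_upwards [hnonpos] with x hx
      simpa using mul_nonpos_of_nonneg_of_nonpos n.cast_nonneg hx
    · filter_upwards [hnonpos] with x hx
      rcases hx.eq_or_lt with rfl | hx
      · simp
      · rw [indicator_of_notMem (s := {0}) hx.ne, ← ENNReal.ofReal_zero]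
        exact ENNReal.tendsto_ofReal (Real.tendsto_exp_atBot.comp
          (tendsto_natCast_atTop_atTop.atTop_mul_const_of_neg hx))
  rw [lintegral_indicator_one (measurableSet_singleton 0)] at hlim
  exact ge_of_tendsto' hlim fun n => iInf_le _ _

theorem iInf_expMoment_le_of_Iio_eq_zero [IsFiniteMeasure μ] (h : μ (Iio 0) = 0) :
    ⨅ t, expMoment μ t ≤ μ {0} := by
  have hneg (t : ℝ) : expMoment (μ.map (-·)) t = expMoment μ (-t) := by
    rw [expMoment_map measurable_neg.aemeasurable, expMoment]
    simp
  have hmap {A : Set ℝ} (hA : MeasurableSet A) : μ.map (-·) A = μ (-A) :=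
    Measure.map_apply measurable_neg hA
  have hreflect := iInf_expMoment_le_of_Ioi_eq_zero (μ := μ.map (-·))
    (by rwa [hmap measurableSet_Ioi, neg_Ioi, neg_zero])
  simp_rw [hmap (measurableSet_singleton 0), hneg, neg_singleton, neg_zero] at hreflect
  rwa [← (Equiv.neg ℝ).iInf_congr fun t => rfl]

theorem exists_restrict_hasDerivAt_mgf_zero [IsFiniteMeasure μ] {r : ℝ}
    (hr : ENNReal.ofReal r < ⨅ t, expMoment μ t) :
    ∃ A, MeasurableSet A ∧ (∀ t, Integrable (fun x => Real.exp (t * x)) (μ.restrict A)) ∧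
      ∃ η, HasDerivAt (mgf id (μ.restrict A)) 0 η ∧ r < mgf id (μ.restrict A) η := by
  by_cases hsides : μ (Ioi 0) ≠ 0 ∧ μ (Iio 0) ≠ 0
  · obtain ⟨K, hlim, hK⟩ := exists_forall_lt_mgf_restrict_closedBall hsides.1 hsides.2 hr
    have hint := integrable_exp_mul_restrict_closedBall μ K
    obtain ⟨η, hη⟩ := exists_hasDerivAt_mgf_zero hint hlim
    exact ⟨_, measurableSet_closedBall, hint, η, hη, hK η⟩
  · have hatom : ⨅ t, expMoment μ t ≤ μ {0} :=
      (not_and_or.mp hsides).elim (fun h => iInf_expMoment_le_of_Ioi_eq_zero (not_not.mp h))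
        fun h => iInf_expMoment_le_of_Iio_eq_zero (not_not.mp h)
    have hmgf : mgf id (μ.restrict {0}) = fun _ => μ.real {0} := by
      ext t
      simp [mgf, Measure.real]
    refine ⟨{0}, measurableSet_singleton 0, fun t => ?_, 0, ?_, ?_⟩
    · simpa using integrable_exp_mul_restrict_closedBall μ 0 t
    · rw [hmgf]
      exact hasDerivAt_const 0 _
    · rw [hmgf]
      rw [← ofReal_measureReal] at hatom
      exact (ENNReal.ofReal_lt_ofReal_iff'.mp (hr.trans_le hatom)).1

end TruncatedTilt

section CramerTheorem

open Set

variable {Ω : Type*} [MeasurableSpace Ω] {P : Measure Ω} {μ : Measure ℝ} {X : ℕ → Ω → ℝ}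

theorem ofReal_exp_lt_iInf_expMoment_map_sub_const {x c : ℝ}
    (hc : legendreTransform (fun t => ENNReal.log (expMoment μ t)) x < c) :
    ENNReal.ofReal (Real.exp (-c)) < ⨅ t, expMoment (μ.map (· - x)) t := by
  obtain ⟨d, hd, hdc⟩ := EReal.lt_iff_exists_real_btwn.mp hc
  refine lt_of_lt_of_le ?_ (le_iInf (a := ENNReal.ofReal (Real.exp (-d))) fun t => ?_)
  · exact (ENNReal.ofReal_lt_ofReal_iff (Real.exp_pos _)).mpr
      (Real.exp_lt_exp.mpr (neg_lt_neg (EReal.coe_lt_coe_iff.mp hdc)))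
  · have hlt := lt_expMoment_of_sub_log_lt ((le_iSup _ t).trans_lt hd)
    rw [expMoment_map_sub_const]
    calc ENNReal.ofReal (Real.exp (-d))
        = ENNReal.ofReal (Real.exp (-(t * x))) * ENNReal.ofReal (Real.exp (t * x - d)) := by
          rw [← ENNReal.ofReal_mul (Real.exp_pos _).le, ← Real.exp_add]
          ring_nf
      _ ≤ _ := by gcongr

theorem mem_ball_empiricalMean_of_abs_sum_sub_lt {Ω : Type*} {X : ℕ → Ω → ℝ} {x δ : ℝ} {n : ℕ}
    {ω : Ω} (h : |∑ i ∈ Finset.range n, (X i ω - x)| < n * δ) :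
    empiricalMean X n ω ∈ Metric.ball x δ := by
  rw [Finset.sum_sub_distrib, ← natCast_mul_empiricalMean, Finset.sum_const, Finset.card_range,
    nsmul_eq_mul, ← mul_sub, abs_mul, Nat.abs_cast] at h
  exact lt_of_mul_lt_mul_left h n.cast_nonneg

theorem eventually_le_measureReal_empiricalMean_mem [IsProbabilityMeasure μ] (hX : iIndepFun X P)
    (hlaw : ∀ i, HasLaw (X i) μ P) {U : Set ℝ} (hU : IsOpen U) {x : ℝ} (hx : x ∈ U) {c : ℝ}
    (hc : legendreTransform (fun t => ENNReal.log (expMoment μ t)) x < c) :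
    ∀ᶠ n : ℕ in atTop, Real.exp (-c * n) ≤ P.real {ω | empiricalMean X n ω ∈ U} := by
  have := (hlaw 0).isProbabilityMeasure
  have := Measure.isProbabilityMeasure_map (μ := μ) (f := (· - x)) (by fun_prop)
  have hX' : iIndepFun (fun i ω => X i ω - x) P := hX.comp (fun _ => (· - x)) fun _ => by fun_prop
  have hlaw' (i : ℕ) : HasLaw (fun ω => X i ω - x) (μ.map (· - x)) P :=
    (HasLaw.mk (X := (· - x)) (by fun_prop) rfl).comp (hlaw i)
  obtain ⟨δ, hδ, hball⟩ := Metric.isOpen_iff.mp hU x hx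
  obtain ⟨A, hA, hint, η, hη, hcη⟩ :=
    exists_restrict_hasDerivAt_mgf_zero (ofReal_exp_lt_iInf_expMoment_map_sub_const hc)
  filter_upwards [eventually_le_measureReal_abs_sum_lt hX' hlaw' hA hint hη hcη hδ] with n hn
  exact hn.trans (measureReal_mono fun ω hω => hball (mem_ball_empiricalMean_of_abs_sum_sub_lt hω))

theorem satisfiesLDP_empiricalMean_legendreTransform [IsProbabilityMeasure μ]
    (hX : iIndepFun X P) (hlaw : ∀ i, HasLaw (X i) μ P) :
    SatisfiesLDP P (empiricalMean X) (fun n => (n : ℝ))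
      (legendreTransform fun t => ENNReal.log (expMoment μ t)) := by
  have := (hlaw 0).isProbabilityMeasure
  refine .of_eventually_bounds (tendsto_natCast_atTop_atTop.eventually_gt_atTop 0)
    (fun x => legendreTransform_nonneg (by simp [expMoment_zero]) x)
    (lowerSemicontinuous_legendreTransform fun t => log_expMoment_ne_bot μ t) ?_ ?_
  · exact fun F _ c hc => eventually_measureReal_empiricalMean_mem_le hX hlaw hc
  · exact fun U hU x hx c hc => eventually_le_measureReal_empiricalMean_mem hX hlaw hU hx hc

end CramerTheorem

section StretchedExponentialUpperBound

open Set

theorem exp_le_one_add_self_add_sq_mul_exp (y : ℝ) :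
    Real.exp y ≤ 1 + y + y ^ 2 * Real.exp (max y 0) := by
  have hself : (1 - y) * Real.exp y ≤ 1 := by
    have h := mul_le_mul_of_nonneg_right (Real.one_sub_le_exp_neg y) (Real.exp_pos y).le
    rwa [← Real.exp_add, neg_add_cancel, Real.exp_zero] at h
  rcases le_total 0 y with hy | hy
  · rw [max_eq_left hy]
    nlinarith [mul_le_mul_of_nonneg_left (by linarith : Real.exp y - 1 ≤ y * Real.exp y) hy]
  · rw [max_eq_right hy, Real.exp_zero, mul_one]
    nlinarith [Real.add_one_le_exp y]

theorem rpow_le_rpow_mul_exp {q ε z : ℝ} (hq : 0 < q) (hε : 0 < ε) (hz : 0 ≤ z) :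
    z ^ q ≤ (q / ε) ^ q * Real.exp (ε * z) :=
  calc z ^ q = (q / ε * (ε * z / q)) ^ q := by field_simp
    _ = (q / ε) ^ q * (ε * z / q) ^ q := Real.mul_rpow (by positivity) (by positivity)
    _ ≤ (q / ε) ^ q * Real.exp (ε * z / q) ^ q := by
        gcongr
        linarith [Real.add_one_le_exp (ε * z / q)]
    _ = (q / ε) ^ q * Real.exp (ε * z) := by rw [← Real.exp_mul, div_mul_cancel₀ _ hq.ne']

-- Below the level `L`, the chord from the origin to `(L, s L ^ α)` lies under the concave function
-- `x ↦ s x ^ α`.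
theorem max_mul_min_le_mul_abs_rpow {α s L : ℝ} (hα0 : 0 ≤ α) (hα : α ≤ 1) (hs : 0 ≤ s)
    (hL : 0 < L) (x : ℝ) : max (s * L ^ α / L * min x L) 0 ≤ s * |x| ^ α := by
  have hnonneg : 0 ≤ s * |x| ^ α := by positivity
  refine max_le ?_ hnonneg
  rcases le_total x 0 with hx | hx
  · exact (mul_nonpos_of_nonneg_of_nonpos (by positivity) ((min_le_left _ _).trans hx)).trans
      hnonneg
  have hmin : 0 ≤ min x L := le_min hx hL.le
  calc s * L ^ α / L * min x L = s * L ^ α * (min x L / L) := by ring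
    _ ≤ s * L ^ α * (min x L / L) ^ α := by
        gcongr
        exact Real.self_le_rpow_of_le_one (by positivity)
          ((div_le_one hL).mpr (min_le_right _ _)) hα
    _ = s * min x L ^ α := by
        rw [Real.div_rpow hmin hL.le]
        field_simp
    _ ≤ s * |x| ^ α := by
        rw [abs_of_nonneg hx]
        gcongr
        exact min_le_left _ _

variable {μ : Measure ℝ} {α s : ℝ}

theorem integrable_abs_pow_mul_exp_abs_rpow (hα : 0 < α) {s' : ℝ} (hs : s < s')
    (hexp : Integrable (fun x => Real.exp (s' * |x| ^ α)) μ) {k : ℕ} (hk : k ≠ 0) :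
    Integrable (fun x => |x| ^ k * Real.exp (s * |x| ^ α)) μ := by
  have : (0 : ℝ) < k := by positivity
  refine (hexp.const_mul ((k / α / (s' - s)) ^ (k / α))).mono'
    (Measurable.aestronglyMeasurable (by fun_prop)) (ae_of_all _ fun x => ?_)
  rw [Real.norm_of_nonneg (by positivity)]
  calc |x| ^ k * Real.exp (s * |x| ^ α) = (|x| ^ α) ^ (k / α) * Real.exp (s * |x| ^ α) := by
        rw [← Real.rpow_mul (abs_nonneg x), mul_div_cancel₀ _ hα.ne', Real.rpow_natCast]
    _ ≤ (k / α / (s' - s)) ^ (k / α) * Real.exp ((s' - s) * |x| ^ α) *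
          Real.exp (s * |x| ^ α) := by
        gcongr
        exact rpow_le_rpow_mul_exp (by positivity) (sub_pos.mpr hs) (by positivity)
    _ = (k / α / (s' - s)) ^ (k / α) * Real.exp (s' * |x| ^ α) := by
        rw [mul_assoc, ← Real.exp_add]
        ring_nf

theorem integrable_id_of_integrable_exp_abs_rpow (hα : 0 < α) (hs : 0 < s)
    (hexp : Integrable (fun x => Real.exp (s * |x| ^ α)) μ) : Integrable id μ := by
  have habs := integrable_abs_pow_mul_exp_abs_rpow hα hs hexp one_ne_zero
  simp only [pow_one, zero_mul, Real.exp_zero, mul_one] at habs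
  exact (integrable_norm_iff aestronglyMeasurable_id).mp habs

theorem expMoment_map_min_le [IsProbabilityMeasure μ] (hμ : Integrable id μ)
    (hmean : ∫ x, x ∂μ ≤ 0) {t L : ℝ} (ht : 0 ≤ t) (hL : 0 ≤ L) {f : ℝ → ℝ}
    (hf : Integrable (fun x => x ^ 2 * Real.exp (f x)) μ)
    (hle : ∀ x, max (t * min x L) 0 ≤ f x) :
    expMoment (μ.map (min · L)) t ≤
      ENNReal.ofReal (Real.exp (t ^ 2 * ∫ x, x ^ 2 * Real.exp (f x) ∂μ)) := by
  have hmin : Integrable (fun x => min x L) μ := hμ.inf (integrable_const L)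
  have hlin : Integrable (fun x => 1 + t * min x L) μ := (integrable_const 1).add (hmin.const_mul t)
  have hpt (x : ℝ) : Real.exp (t * min x L) ≤
      (1 + t * min x L) + t ^ 2 * (x ^ 2 * Real.exp (f x)) := by
    refine (exp_le_one_add_self_add_sq_mul_exp _).trans ?_
    have hsq : min x L ^ 2 ≤ x ^ 2 := by
      rcases min_choice x L with h | h
      · rw [h]
      · rw [h]
        exact pow_le_pow_left₀ hL (min_eq_right_iff.mp h) 2
    rw [mul_pow, mul_assoc]
    gcongr
    exact hle x
  rw [expMoment_map (by fun_prop)]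
  calc ∫⁻ x, ENNReal.ofReal (Real.exp (t * min x L)) ∂μ
      ≤ ∫⁻ x, ENNReal.ofReal ((1 + t * min x L) + t ^ 2 * (x ^ 2 * Real.exp (f x))) ∂μ :=
        lintegral_mono fun x => ENNReal.ofReal_le_ofReal (hpt x)
    _ = ENNReal.ofReal (∫ x, (1 + t * min x L) + t ^ 2 * (x ^ 2 * Real.exp (f x)) ∂μ) :=
        (ofReal_integral_eq_lintegral_ofReal (hlin.add (hf.const_mul _))
          (ae_of_all _ fun x => (Real.exp_pos _).le.trans (hpt x))).symm
    _ ≤ _ := by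
        refine ENNReal.ofReal_le_ofReal (le_trans ?_ (Real.add_one_le_exp _))
        rw [integral_add hlin (hf.const_mul _), integral_add (integrable_const 1)
          (hmin.const_mul t), integral_const_mul, integral_const_mul,
          integral_const, probReal_univ, one_smul]
        have : ∫ x, min x L ∂μ ≤ 0 := (integral_mono hmin hμ fun x => min_le_left _ _).trans hmean
        linarith [mul_nonpos_of_nonneg_of_nonpos ht this]

theorem measureReal_Ici_le [IsFiniteMeasure μ] (hα : 0 ≤ α) (hs : 0 ≤ s)
    (hexp : Integrable (fun x => Real.exp (s * |x| ^ α)) μ) {t : ℝ} (ht : 0 ≤ t) :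
    μ.real (Ici t) ≤ (∫ x, Real.exp (s * |x| ^ α) ∂μ) * Real.exp (-(s * t ^ α)) := by
  rw [Real.exp_neg, ← div_eq_mul_inv, le_div_iff₀ (Real.exp_pos _), mul_comm]
  have hmarkov := mul_meas_ge_le_integral_of_nonneg
    (ae_of_all μ fun x => (Real.exp_pos (s * |x| ^ α)).le) hexp (Real.exp (s * t ^ α))
  refine le_trans (mul_le_mul_of_nonneg_left (measureReal_mono fun x hx => ?_)
    (Real.exp_pos _).le) hmarkov
  have : t ≤ |x| := (mem_Ici.mp hx).trans (le_abs_self x)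
  exact Real.exp_le_exp.mpr (by gcongr)

theorem eventually_natCast_mul_exp_le_exp {K b c : ℝ} (hcb : c < b) (hα : 0 < α) :
    ∀ᶠ n : ℕ in atTop, n * (K * Real.exp (-b * (n : ℝ) ^ α)) ≤ Real.exp (-c * (n : ℝ) ^ α) := by
  obtain ⟨d, hcd, hdb⟩ := exists_between hcb
  set C := (1 / α / (b - d)) ^ (1 / α)
  filter_upwards [eventually_mul_exp_le_exp (K := |K| * C) hcd
    ((tendsto_rpow_atTop hα).comp tendsto_natCast_atTop_atTop)] with n hn
  have hpoly : (n : ℝ) ≤ C * Real.exp ((b - d) * (n : ℝ) ^ α) := by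
    have h := rpow_le_rpow_mul_exp (one_div_pos.mpr hα) (sub_pos.mpr hdb)
      (Real.rpow_nonneg n.cast_nonneg α)
    rwa [← Real.rpow_mul n.cast_nonneg, mul_one_div_cancel hα.ne', Real.rpow_one] at h
  calc n * (K * Real.exp (-b * (n : ℝ) ^ α))
      ≤ n * (|K| * Real.exp (-b * (n : ℝ) ^ α)) := by
        gcongr
        exact le_abs_self K
    _ ≤ (C * Real.exp ((b - d) * (n : ℝ) ^ α)) * (|K| * Real.exp (-b * (n : ℝ) ^ α)) := by
        gcongr
    _ = |K| * C * Real.exp (-d * (n : ℝ) ^ α) := by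
        rw [mul_mul_mul_comm, ← Real.exp_add]
        ring_nf
    _ ≤ _ := hn

end StretchedExponentialUpperBound

section StretchedExponentialSumUpperBound

open Set

variable {Ω : Type*} [MeasurableSpace Ω] {P : Measure Ω} {μ : Measure ℝ} {X : ℕ → Ω → ℝ}
  {α κ : ℝ}

theorem measureReal_le_sum_le_add [IsFiniteMeasure P] (hlaw : ∀ i, HasLaw (X i) μ P) (L : ℝ)
    (n : ℕ) : P.real {ω | L ≤ ∑ i ∈ Finset.range n, X i ω} ≤
      n * μ.real (Ici L) + P.real {ω | L ≤ ∑ i ∈ Finset.range n, min (X i ω) L} := by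
  have hjump (i : ℕ) : P.real {ω | L ≤ X i ω} = μ.real (Ici L) :=
    (hlaw i).measureReal_eq measurableSet_Ici
  calc P.real {ω | L ≤ ∑ i ∈ Finset.range n, X i ω}
      ≤ P.real ((⋃ i ∈ Finset.range n, {ω | L ≤ X i ω}) ∪
          {ω | L ≤ ∑ i ∈ Finset.range n, min (X i ω) L}) := by
        refine measureReal_mono fun ω hω => ?_
        by_cases h : ∃ i ∈ Finset.range n, L ≤ X i ω
        · obtain ⟨i, hi, hiL⟩ := h
          exact .inl (mem_biUnion hi hiL)
        · push Not at h
          refine .inr (mem_ofPred.mpr ?_)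
          rwa [Finset.sum_congr rfl fun i hi => min_eq_left (h i hi).le]
    _ ≤ (∑ i ∈ Finset.range n, P.real {ω | L ≤ X i ω}) +
          P.real {ω | L ≤ ∑ i ∈ Finset.range n, min (X i ω) L} :=
        (measureReal_union_le _ _).trans (add_le_add_left (measureReal_biUnion_finset_le _ _) _)
    _ = _ := by simp [hjump]

theorem measureReal_le_sum_min_le [IsProbabilityMeasure μ] (hX : iIndepFun X P)
    (hlaw : ∀ i, HasLaw (X i) μ P) (hα : 0 < α) (hα1 : α ≤ 1) (hmean : ∫ x, x ∂μ ≤ 0) {s s' : ℝ}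
    (hs : 0 ≤ s) (hss' : s < s') (hexp : Integrable (fun x => Real.exp (s' * |x| ^ α)) μ) {L : ℝ}
    (hL : 0 < L) (n : ℕ) :
    P.real {ω | L ≤ ∑ i ∈ Finset.range n, min (X i ω) L} ≤
      Real.exp (-(s * L ^ α) +
        n * ((s * L ^ α / L) ^ 2 * ∫ x, x ^ 2 * Real.exp (s * |x| ^ α) ∂μ)) := by
  have hmin : Measurable fun x : ℝ => min x L := by fun_prop
  have := Measure.isProbabilityMeasure_map (μ := μ) hmin.aemeasurable
  have hX' : iIndepFun (fun i ω => min (X i ω) L) P := hX.comp (fun _ x => min x L) fun _ => hmin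
  have hlaw' (i : ℕ) : HasLaw (fun ω => min (X i ω) L) (μ.map (min · L)) P :=
    (HasLaw.mk (X := (min · L)) hmin.aemeasurable rfl).comp (hlaw i)
  have hsq : Integrable (fun x => x ^ 2 * Real.exp (s * |x| ^ α)) μ := by
    simpa using integrable_abs_pow_mul_exp_abs_rpow hα hss' hexp two_ne_zero
  have hmoment := expMoment_map_min_le
    (integrable_id_of_integrable_exp_abs_rpow hα (hs.trans_lt hss') hexp) hmean
    (by positivity : 0 ≤ s * L ^ α / L) hL.le hsq
    (max_mul_min_le_mul_abs_rpow hα.le hα1 hs hL)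
  have hchernoff := measure_le_mul_le_exp_mul_expMoment
    (P.map fun ω => ∑ i ∈ Finset.range n, min (X i ω) L) (s * L ^ α / L) (s * L ^ α)
  have hevent : {x : ℝ | s * L ^ α ≤ s * L ^ α / L * x} ⊇ Ici L := fun x hx => by
    rw [mem_ofPred]
    calc s * L ^ α = s * L ^ α / L * L := by field_simp
      _ ≤ s * L ^ α / L * x := by
        gcongr
        exact hx
  rw [expMoment_map_sum hX' hlaw'] at hchernoff
  refine ENNReal.toReal_le_of_le_ofReal (Real.exp_pos _).le ?_
  rw [Real.exp_add, Real.exp_nat_mul, ENNReal.ofReal_mul (Real.exp_pos _).le,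
    ENNReal.ofReal_pow (Real.exp_pos _).le]
  exact (Measure.le_map_apply (aemeasurable_sum_range hlaw' n) (Ici L)).trans <|
    (measure_mono hevent).trans <| hchernoff.trans <| by gcongr

theorem eventually_measureReal_le_sum_min_le [IsProbabilityMeasure μ] (hX : iIndepFun X P)
    (hlaw : ∀ i, HasLaw (X i) μ P) (hα : 0 < α) (hα1 : α < 1) (hmean : ∫ x, x ∂μ ≤ 0) {s s' : ℝ}
    (hs : 0 ≤ s) (hss' : s < s') (hexp : Integrable (fun x => Real.exp (s' * |x| ^ α)) μ)
    {a c : ℝ} (ha : 0 < a) (hc : c < s * a ^ α) :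
    ∀ᶠ n : ℕ in atTop, P.real {ω | n * a ≤ ∑ i ∈ Finset.range n, min (X i ω) (n * a)} ≤
      Real.exp (-c * (n : ℝ) ^ α) := by
  set C := ∫ x, x ^ 2 * Real.exp (s * |x| ^ α) ∂μ
  have hcorrection : Tendsto (fun n : ℕ => (s * a ^ α / a) ^ 2 * C * (n : ℝ) ^ (α - 1)) atTop
      (𝓝 0) := by
    have h := (tendsto_rpow_neg_atTop (sub_pos.mpr hα1)).comp
      (tendsto_natCast_atTop_atTop (R := ℝ))
    simpa [Function.comp_def] using h.const_mul ((s * a ^ α / a) ^ 2 * C)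
  filter_upwards [hcorrection.eventually_lt_const (sub_pos.mpr hc), eventually_gt_atTop 0]
    with n hn hn0
  have hn' : (0 : ℝ) < n := by exact_mod_cast hn0
  refine (measureReal_le_sum_min_le hX hlaw hα hα1.le hmean hs hss' hexp (mul_pos hn' ha) n).trans
    (Real.exp_le_exp.mpr ?_)
  calc -(s * (n * a) ^ α) + n * ((s * (n * a) ^ α / (n * a)) ^ 2 * C)
      = -(s * a ^ α - (s * a ^ α / a) ^ 2 * C * (n : ℝ) ^ (α - 1)) * (n : ℝ) ^ α := by
        rw [Real.mul_rpow hn'.le ha.le, Real.rpow_sub_one hn'.ne']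
        field_simp
        ring
    _ ≤ -c * (n : ℝ) ^ α := by
        gcongr
        linarith

theorem eventually_measureReal_le_sum_le [IsProbabilityMeasure μ] (hX : iIndepFun X P)
    (hlaw : ∀ i, HasLaw (X i) μ P) (hα : 0 < α) (hα1 : α < 1) (hκ : 0 < κ)
    (hmean : ∫ x, x ∂μ ≤ 0) (hexp : ∀ s < κ, Integrable (fun x => Real.exp (s * |x| ^ α)) μ)
    {a c : ℝ} (ha : 0 < a) (hc : c < κ * a ^ α) :
    ∀ᶠ n : ℕ in atTop,
      P.real {ω | n * a ≤ ∑ i ∈ Finset.range n, X i ω} ≤ 2 * Real.exp (-c * (n : ℝ) ^ α) := by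
  have := (hlaw 0).isProbabilityMeasure
  have haα : 0 < a ^ α := by positivity
  obtain ⟨s, hs, hsκ⟩ := exists_between (max_lt ((div_lt_iff₀ haα).mpr hc) hκ)
  obtain ⟨s', hss', hs'κ⟩ := exists_between hsκ
  have hs0 : 0 ≤ s := (le_max_right _ _).trans hs.le
  have hcs : c < s * a ^ α := (div_lt_iff₀ haα).mp ((le_max_left _ _).trans_lt hs)
  filter_upwards [eventually_measureReal_le_sum_min_le hX hlaw hα hα1 hmean hs0 hss'
    (hexp s' hs'κ) ha hcs, eventually_natCast_mul_exp_le_exp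
      (K := ∫ x, Real.exp (s * |x| ^ α) ∂μ) hcs hα] with n hbulk hjump
  have htail := measureReal_Ici_le hα.le hs0 (hexp s hsκ) (t := n * a) (by positivity)
  rw [Real.mul_rpow n.cast_nonneg ha.le, mul_left_comm, ← mul_comm (s * a ^ α), ← neg_mul] at htail
  calc P.real {ω | n * a ≤ ∑ i ∈ Finset.range n, X i ω}
      ≤ n * μ.real (Ici (n * a)) +
          P.real {ω | n * a ≤ ∑ i ∈ Finset.range n, min (X i ω) (n * a)} :=
        measureReal_le_sum_le_add hlaw _ n
    _ ≤ n * ((∫ x, Real.exp (s * |x| ^ α) ∂μ) * Real.exp (-(s * a ^ α) * (n : ℝ) ^ α)) +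
          Real.exp (-c * (n : ℝ) ^ α) := by gcongr
    _ ≤ 2 * Real.exp (-c * (n : ℝ) ^ α) := by linarith

theorem measureReal_abs_empiricalMean_ge_le [IsFiniteMeasure P] {a : ℝ} (n : ℕ) :
    P.real {ω | a ≤ |empiricalMean X n ω|} ≤
      P.real {ω | n * a ≤ ∑ i ∈ Finset.range n, X i ω} +
        P.real {ω | n * a ≤ ∑ i ∈ Finset.range n, -X i ω} := by
  refine (measureReal_mono fun ω hω => ?_).trans (measureReal_union_le _ _)
  simp only [mem_union, mem_ofPred, Finset.sum_neg_distrib, ← natCast_mul_empiricalMean,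
    ← mul_neg] at hω ⊢
  exact (le_abs.mp hω).imp (mul_le_mul_of_nonneg_left · n.cast_nonneg)
    (mul_le_mul_of_nonneg_left · n.cast_nonneg)

theorem integrable_exp_abs_rpow_map_neg {s : ℝ}
    (hexp : Integrable (fun x => Real.exp (s * |x| ^ α)) μ) :
    Integrable (fun x => Real.exp (s * |x| ^ α)) (μ.map (-·)) := by
  rw [integrable_map_measure (Measurable.aestronglyMeasurable (by fun_prop)) (by fun_prop)]
  simpa [Function.comp_def] using hexp

theorem eventually_measureReal_abs_empiricalMean_ge_le [IsProbabilityMeasure μ]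
    (hX : iIndepFun X P) (hlaw : ∀ i, HasLaw (X i) μ P) (hα : 0 < α) (hα1 : α < 1) (hκ : 0 < κ)
    (hmean : ∫ x, x ∂μ = 0) (hexp : ∀ s < κ, Integrable (fun x => Real.exp (s * |x| ^ α)) μ)
    {a c : ℝ} (ha : 0 < a) (hc : c < κ * a ^ α) :
    ∀ᶠ n : ℕ in atTop,
      P.real {ω | a ≤ |empiricalMean X n ω|} ≤ Real.exp (-c * (n : ℝ) ^ α) := by
  have := (hlaw 0).isProbabilityMeasure
  have := Measure.isProbabilityMeasure_map (μ := μ) measurable_neg.aemeasurable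
  obtain ⟨d, hcd, hd⟩ := exists_between hc
  have hX' : iIndepFun (fun i ω => -X i ω) P := hX.comp (fun _ x => -x) fun _ => measurable_neg
  have hlaw' (i : ℕ) : HasLaw (fun ω => -X i ω) (μ.map (-·)) P :=
    (HasLaw.mk measurable_neg.aemeasurable rfl).comp (hlaw i)
  have hmean' : ∫ x, x ∂μ.map (-·) = 0 := by
    rw [integral_map measurable_neg.aemeasurable (by fun_prop), integral_neg, hmean, neg_zero]
  filter_upwards [eventually_measureReal_le_sum_le hX hlaw hα hα1 hκ hmean.le hexp ha hd,
    eventually_measureReal_le_sum_le hX' hlaw' hα hα1 hκ hmean'.le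
      (fun s hs => integrable_exp_abs_rpow_map_neg (hexp s hs)) ha hd,
    eventually_mul_exp_le_exp (K := 4) hcd
      ((tendsto_rpow_atTop hα).comp tendsto_natCast_atTop_atTop)] with n hupper hlower hslack
  have := measureReal_abs_empiricalMean_ge_le (P := P) (X := X) (a := a) n
  simp only [Function.comp_apply] at hslack
  linarith

theorem eventually_measureReal_empiricalMean_mem_le_exp_rpow [IsProbabilityMeasure μ]
    (hX : iIndepFun X P) (hlaw : ∀ i, HasLaw (X i) μ P) (hα : 0 < α) (hα1 : α < 1) (hκ : 0 < κ)
    (hmean : ∫ x, x ∂μ = 0) (hexp : ∀ s < κ, Integrable (fun x => Real.exp (s * |x| ^ α)) μ)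
    {F : Set ℝ} {c : ℝ} (hc : (c : EReal) < ⨅ x ∈ F, ((κ * |x| ^ α : ℝ) : EReal)) :
    ∀ᶠ n : ℕ in atTop,
      P.real {ω | empiricalMean X n ω ∈ F} ≤ Real.exp (-c * (n : ℝ) ^ α) := by
  have := (hlaw 0).isProbabilityMeasure
  rcases lt_or_ge c 0 with hc0 | hc0
  · refine Eventually.of_forall fun n => measureReal_le_one.trans (Real.one_le_exp ?_)
    have := neg_pos.mpr hc0
    positivity
  obtain ⟨b, hcb, hb⟩ := EReal.lt_iff_exists_real_btwn.mp hc
  have hb0 : 0 < b := hc0.trans_lt (EReal.coe_lt_coe_iff.mp hcb)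
  set a := (b / κ) ^ (1 / α)
  have ha : 0 < a := by positivity
  have haα : κ * a ^ α = b := by
    rw [← Real.rpow_mul (by positivity), one_div_mul_cancel hα.ne', Real.rpow_one,
      mul_div_cancel₀ _ hκ.ne']
  have hlarge : F ⊆ {x | a ≤ |x|} := fun x hx => by
    have h : b ≤ κ * |x| ^ α := EReal.coe_le_coe_iff.mp (hb.le.trans (iInf₂_le x hx))
    rw [← haα, mul_le_mul_iff_right₀ hκ, Real.rpow_le_rpow_iff ha.le (abs_nonneg x) hα] at h
    exact h
  filter_upwards [eventually_measureReal_abs_empiricalMean_ge_le hX hlaw hα hα1 hκ hmean hexp ha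
    (haα ▸ EReal.coe_lt_coe_iff.mp hcb)] with n hn
  have hmono : P.real {ω | empiricalMean X n ω ∈ F} ≤ P.real {ω | a ≤ |empiricalMean X n ω|} :=
    measureReal_mono fun ω hω => hlarge hω
  exact hmono.trans hn

end StretchedExponentialSumUpperBound

section StretchedExponentialLDP

open Set

/-- The law `μ` has stretched exponential tails of index `α` and rate `κ`: in the logarithmic sense
both `μ (Ici t)` and `μ (Iic (-t))` behave like `exp (-κ t ^ α)` as `t → ∞`. The upper bounds are
encoded as moment conditions, which are uniform in `t`. -/
structure HasStretchedExpTails (μ : Measure ℝ) (κ α : ℝ) : Prop where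
  integrable_exp : ∀ s < κ, Integrable (fun x => Real.exp (s * |x| ^ α)) μ
  le_Ici : ∀ c, κ < c → ∀ᶠ t in atTop, Real.exp (-c * t ^ α) ≤ μ.real (Ici t)
  le_Iic : ∀ c, κ < c → ∀ᶠ t in atTop, Real.exp (-c * t ^ α) ≤ μ.real (Iic (-t))

variable {Ω : Type*} [MeasurableSpace Ω] {P : Measure Ω} {μ : Measure ℝ} {X : ℕ → Ω → ℝ}
  {α κ : ℝ}

theorem HasStretchedExpTails.map_neg (h : HasStretchedExpTails μ κ α) :
    HasStretchedExpTails (μ.map (-·)) κ α where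
  integrable_exp s hs := integrable_exp_abs_rpow_map_neg (h.integrable_exp s hs)
  le_Ici c hc := by
    simpa [map_measureReal_apply measurable_neg measurableSet_Ici] using h.le_Iic c hc
  le_Iic c hc := by
    simpa [map_measureReal_apply measurable_neg measurableSet_Iic] using h.le_Ici c hc

theorem HasStretchedExpTails.eventually_le_Ici (h : HasStretchedExpTails μ κ α) {y c : ℝ}
    (hy : 0 < y) (hc : κ * y ^ α < c) :
    ∀ᶠ n : ℕ in atTop, Real.exp (-c * (n : ℝ) ^ α) ≤ μ.real (Ici (n * y)) := by
  have hyα : 0 < y ^ α := by positivity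
  have hny : Tendsto (fun n : ℕ => (n : ℝ) * y) atTop atTop :=
    tendsto_natCast_atTop_atTop.atTop_mul_const hy
  filter_upwards [hny.eventually (h.le_Ici (c / y ^ α) ((lt_div_iff₀ hyα).mpr hc))] with n hn
  rwa [Real.mul_rpow n.cast_nonneg hy.le, mul_comm ((n : ℝ) ^ α), ← mul_assoc, neg_mul,
    div_mul_cancel₀ _ hyα.ne'] at hn

theorem HasStretchedExpTails.eventually_Ici_le [IsFiniteMeasure μ]
    (h : HasStretchedExpTails μ κ α) (hα : 0 < α) (hκ : 0 < κ) {y c : ℝ} (hy : 0 < y)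
    (hc : c < κ * y ^ α) :
    ∀ᶠ n : ℕ in atTop, μ.real (Ici (n * y)) ≤ Real.exp (-c * (n : ℝ) ^ α) := by
  have hyα : 0 < y ^ α := by positivity
  obtain ⟨s, hs, hsκ⟩ := exists_between (max_lt ((div_lt_iff₀ hyα).mpr hc) hκ)
  have hs0 : 0 ≤ s := (le_max_right _ _).trans hs.le
  have hcs : c < s * y ^ α := (div_lt_iff₀ hyα).mp ((le_max_left _ _).trans_lt hs)
  filter_upwards [eventually_mul_exp_le_exp (K := ∫ x, Real.exp (s * |x| ^ α) ∂μ) hcs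
    ((tendsto_rpow_atTop hα).comp tendsto_natCast_atTop_atTop)] with n hn
  refine (measureReal_Ici_le hα.le hs0 (h.integrable_exp s hsκ) (by positivity)).trans ?_
  rwa [Real.mul_rpow n.cast_nonneg hy.le, mul_comm ((n : ℝ) ^ α), ← mul_assoc, ← neg_mul]

theorem HasStretchedExpTails.eventually_le_ball_of_nonneg [IsFiniteMeasure μ]
    (h : HasStretchedExpTails μ κ α) (hα : 0 < α) (hκ : 0 < κ) {x δ c : ℝ} (hx : 0 ≤ x)
    (hδ : 0 < δ) (hc : κ * x ^ α < c) :
    ∀ᶠ n : ℕ in atTop,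
      Real.exp (-c * (n : ℝ) ^ α) ≤ μ.real (Metric.ball (n * x) (n * δ)) := by
  obtain ⟨y, hyc, hxy, hyδ⟩ : ∃ y, κ * y ^ α < c ∧ x < y ∧ y < x + δ := by
    have hcont : ContinuousAt (fun y : ℝ => κ * y ^ α) x :=
      (Real.continuousAt_rpow_const x α (.inr hα.le)).const_mul κ
    exact (((hcont.eventually_lt_const hc).filter_mono nhdsWithin_le_nhds).and
      (Ioo_mem_nhdsGT (lt_add_of_pos_right x hδ))).exists
  have hy : 0 < y := hx.trans_lt hxy
  have hyz : κ * y ^ α < κ * (x + δ) ^ α :=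
    (mul_lt_mul_iff_right₀ hκ).mpr (Real.rpow_lt_rpow hy.le hyδ hα)
  obtain ⟨b, hyb, hb⟩ := exists_between (lt_min hyc hyz)
  obtain ⟨d, hbd, hd⟩ := exists_between (hb.trans_le (min_le_right _ _))
  have hv : Tendsto (fun n : ℕ => (n : ℝ) ^ α) atTop atTop :=
    (tendsto_rpow_atTop hα).comp tendsto_natCast_atTop_atTop
  filter_upwards [h.eventually_le_Ici hy hyb, h.eventually_Ici_le hα hκ (hy.trans hyδ) hd,
    eventually_mul_exp_le_exp (K := 2) (hb.trans_le (min_le_left _ _)) hv,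
    eventually_mul_exp_le_exp (K := 2) hbd hv, eventually_gt_atTop 0]
    with n hnear hfar hslack hslack' hn
  have hn' : (0 : ℝ) < n := by exact_mod_cast hn
  have hcover : Ici (n * y) ⊆ Metric.ball (n * x) (n * δ) ∪ Ici (n * (x + δ)) := fun u hu => by
    rcases le_or_gt (n * (x + δ)) u with hu' | hu'
    · exact .inr hu'
    · have := mul_lt_mul_of_pos_left hxy hn'
      have := mul_pos hn' hδ
      refine .inl ?_
      rw [Real.ball_eq_Ioo]
      exact ⟨by linarith [mem_Ici.mp hu], by linarith⟩
  have := (measureReal_mono (μ := μ) hcover).trans (measureReal_union_le _ _)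
  linarith

theorem HasStretchedExpTails.eventually_le_ball [IsFiniteMeasure μ]
    (h : HasStretchedExpTails μ κ α) (hα : 0 < α) (hκ : 0 < κ) {x δ c : ℝ}
    (hδ : 0 < δ) (hc : κ * |x| ^ α < c) :
    ∀ᶠ n : ℕ in atTop,
      Real.exp (-c * (n : ℝ) ^ α) ≤ μ.real (Metric.ball (n * x) (n * δ)) := by
  rcases le_total 0 x with hx | hx
  · exact h.eventually_le_ball_of_nonneg hα hκ hx hδ (by rwa [abs_of_nonneg hx] at hc)
  · have hneg (n : ℕ) : (-· : ℝ → ℝ) ⁻¹' Metric.ball (n * -x) (n * δ) =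
        Metric.ball (n * x) (n * δ) := by
      ext u
      simp [dist_eq_norm, ← norm_neg (u - n * x)]
    filter_upwards [h.map_neg.eventually_le_ball_of_nonneg hα hκ (neg_nonneg.mpr hx) hδ
      (by rwa [abs_of_nonpos hx] at hc)] with n hn
    rwa [map_measureReal_apply measurable_neg Metric.isOpen_ball.measurableSet, hneg] at hn

theorem eventually_le_measureReal_empiricalMean_mem_ball_integral [IsProbabilityMeasure μ]
    (hX : iIndepFun X P) (hlaw : ∀ i, HasLaw (X i) μ P) (hμ : Integrable id μ) {r a : ℝ}
    (hr : 0 < r) (ha : a < 1) :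
    ∀ᶠ n : ℕ in atTop,
      a ≤ P.real {ω | empiricalMean X n ω ∈ Metric.ball (∫ x, x ∂μ) r} := by
  have := (hlaw 0).isProbabilityMeasure
  have hident (i : ℕ) : IdentDistrib (X i) (X 0) P P :=
    ⟨(hlaw i).aemeasurable, (hlaw 0).aemeasurable, (hlaw i).map_eq.trans (hlaw 0).map_eq.symm⟩
  have hint : Integrable (X 0) P := by
    rw [← (hlaw 0).map_eq] at hμ
    exact hμ.comp_aemeasurable (hlaw 0).aemeasurable
  have hslln : ∀ᵐ ω ∂P, Tendsto (empiricalMean X · ω) atTop (𝓝 (∫ x, x ∂μ)) := by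
    rw [← (hlaw 0).integral_eq]
    simpa only [empiricalMean, one_div_mul_eq_div] using
      strong_law_ae_real X hint (fun i j hij => hX.indepFun hij) hident
  have hwlln := tendstoInMeasure_iff_measureReal_dist.mp
    (tendstoInMeasure_of_tendsto_ae
      (fun n => (aemeasurable_empiricalMean hlaw n).aestronglyMeasurable) hslln) r hr
  filter_upwards [hwlln.eventually_lt_const (sub_pos.mpr ha)] with n hn
  have hcover : univ ⊆ {ω | empiricalMean X n ω ∈ Metric.ball (∫ x, x ∂μ) r} ∪
      {ω | r ≤ dist (empiricalMean X n ω) (∫ x, x ∂μ)} := fun ω _ =>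
    (lt_or_ge (dist (empiricalMean X n ω) (∫ x, x ∂μ)) r).imp mem_ofPred.mpr mem_ofPred.mpr
  have := (measureReal_mono (μ := P) hcover).trans (measureReal_union_le _ _)
  rw [probReal_univ] at this
  linarith

theorem empiricalMean_succ_mem_ball {Ω : Type*} {X : ℕ → Ω → ℝ} {x r : ℝ} {n : ℕ} {ω : Ω}
    (hbulk : empiricalMean X n ω ∈ Metric.ball 0 r)
    (hjump : X n ω ∈ Metric.ball ((n + 1 : ℕ) * x) ((n + 1 : ℕ) * r)) :
    empiricalMean X (n + 1) ω ∈ Metric.ball x (2 * r) := by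
  rw [mem_ball_zero_iff, Real.norm_eq_abs] at hbulk
  rw [Metric.mem_ball, Real.dist_eq] at hjump ⊢
  have : 0 ≤ r := (abs_nonneg _).trans hbulk.le
  refine lt_of_mul_lt_mul_left ?_ (n + 1).cast_nonneg
  calc ((n + 1 : ℕ) : ℝ) * |empiricalMean X (n + 1) ω - x|
      = |n * empiricalMean X n ω + (X n ω - (n + 1 : ℕ) * x)| := by
        rw [← Nat.abs_cast (n + 1), ← abs_mul, mul_sub, natCast_mul_empiricalMean,
          natCast_mul_empiricalMean, Finset.sum_range_succ, Nat.abs_cast, add_sub_assoc]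
    _ ≤ n * |empiricalMean X n ω| + |X n ω - (n + 1 : ℕ) * x| := by
        simpa [abs_mul] using abs_add_le (n * empiricalMean X n ω) (X n ω - (n + 1 : ℕ) * x)
    _ < (n + 1 : ℕ) * r + (n + 1 : ℕ) * r := by
        refine add_lt_add_of_le_of_lt ?_ hjump
        gcongr
        exact n.le_succ
    _ = (n + 1 : ℕ) * (2 * r) := by ring

theorem measureReal_mul_measureReal_ball_le [IsFiniteMeasure P] (hX : iIndepFun X P)
    (hlaw : ∀ i, HasLaw (X i) μ P) (x r : ℝ) (n : ℕ) :
    P.real {ω | empiricalMean X n ω ∈ Metric.ball 0 r} *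
        μ.real (Metric.ball ((n + 1 : ℕ) * x) ((n + 1 : ℕ) * r)) ≤
      P.real {ω | empiricalMean X (n + 1) ω ∈ Metric.ball x (2 * r)} := by
  have hindep : IndepFun (empiricalMean X n) (X n) P := by
    have h : IndepFun (fun ω => ∑ i ∈ Finset.range n, X i ω) (X n) P := by
      simpa only [Finset.sum_fn] using
        hX.indepFun_finsetSum_of_notMem₀ (fun i => (hlaw i).aemeasurable) Finset.notMem_range_self
    exact h.comp (φ := ((1 / (n : ℝ)) * ·)) (by fun_prop) measurable_id
  have hball (y s : ℝ) : MeasurableSet (Metric.ball y s) := Metric.isOpen_ball.measurableSet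
  have hmul := hindep.measure_inter_preimage_eq_mul (Metric.ball 0 r)
    (Metric.ball ((n + 1 : ℕ) * x) ((n + 1 : ℕ) * r)) (hball _ _) (hball _ _)
  have hjump : P.real (X n ⁻¹' Metric.ball ((n + 1 : ℕ) * x) ((n + 1 : ℕ) * r)) =
      μ.real (Metric.ball ((n + 1 : ℕ) * x) ((n + 1 : ℕ) * r)) :=
    (hlaw n).measureReal_eq (hball _ _)
  calc P.real (empiricalMean X n ⁻¹' Metric.ball 0 r) *
        μ.real (Metric.ball ((n + 1 : ℕ) * x) ((n + 1 : ℕ) * r))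
      = P.real (empiricalMean X n ⁻¹' Metric.ball 0 r ∩
          X n ⁻¹' Metric.ball ((n + 1 : ℕ) * x) ((n + 1 : ℕ) * r)) := by
        rw [← hjump, measureReal_def, measureReal_def, measureReal_def, hmul, ENNReal.toReal_mul]
    _ ≤ P.real {ω | empiricalMean X (n + 1) ω ∈ Metric.ball x (2 * r)} :=
        measureReal_mono fun ω hω => empiricalMean_succ_mem_ball hω.1 hω.2

theorem eventually_le_measureReal_empiricalMean_mem_exp_rpow [IsProbabilityMeasure μ]
    (hX : iIndepFun X P) (hlaw : ∀ i, HasLaw (X i) μ P) (hα : 0 < α) (hκ : 0 < κ)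
    (hmean : ∫ x, x ∂μ = 0) (h : HasStretchedExpTails μ κ α) {U : Set ℝ} (hU : IsOpen U) {x : ℝ}
    (hx : x ∈ U) {c : ℝ} (hc : κ * |x| ^ α < c) :
    ∀ᶠ n : ℕ in atTop,
      Real.exp (-c * (n : ℝ) ^ α) ≤ P.real {ω | empiricalMean X n ω ∈ U} := by
  have := (hlaw 0).isProbabilityMeasure
  obtain ⟨δ, hδ, hball⟩ := Metric.isOpen_iff.mp hU x hx
  obtain ⟨b, hb, hbc⟩ := exists_between hc
  obtain ⟨s, hs, hsκ⟩ := exists_between hκ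
  have hμ := integrable_id_of_integrable_exp_abs_rpow hα hs (h.integrable_exp s hsκ)
  have hbulk := eventually_le_measureReal_empiricalMean_mem_ball_integral hX hlaw hμ
    (half_pos hδ) one_half_lt_one
  filter_upwards [(tendsto_sub_atTop_nat 1).eventually hbulk,
    h.eventually_le_ball hα hκ (half_pos hδ) hb, eventually_ge_atTop 1,
    eventually_mul_exp_le_exp (K := 2) hbc
      ((tendsto_rpow_atTop hα).comp tendsto_natCast_atTop_atTop)] with n hbulk hjump hn hslack
  have hsplit := measureReal_mul_measureReal_ball_le hX hlaw x (δ / 2) (n - 1)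
  rw [Nat.sub_add_cancel hn, mul_div_cancel₀ _ two_ne_zero] at hsplit
  rw [hmean] at hbulk
  have hmono : P.real {ω | empiricalMean X n ω ∈ Metric.ball x δ} ≤
      P.real {ω | empiricalMean X n ω ∈ U} := measureReal_mono fun ω hω => hball hω
  have hprod := mul_le_mul hbulk hjump (Real.exp_pos _).le measureReal_nonneg
  simp only [Function.comp_apply] at hslack
  linarith

theorem HasStretchedExpTails.satisfiesLDP_empiricalMean [IsProbabilityMeasure μ]
    (h : HasStretchedExpTails μ κ α) (hX : iIndepFun X P) (hlaw : ∀ i, HasLaw (X i) μ P)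
    (hα : 0 < α) (hα1 : α < 1) (hκ : 0 < κ) (hmean : ∫ x, x ∂μ = 0) :
    SatisfiesLDP P (empiricalMean X) (fun n => (n : ℝ) ^ α)
      (fun x => ((κ * |x| ^ α : ℝ) : EReal)) := by
  have := (hlaw 0).isProbabilityMeasure
  have hv : Tendsto (fun n : ℕ => (n : ℝ) ^ α) atTop atTop :=
    (tendsto_rpow_atTop hα).comp tendsto_natCast_atTop_atTop
  refine .of_eventually_bounds (hv.eventually_gt_atTop 0) (fun x => ?_) ?_ ?_ ?_
  · exact_mod_cast (by positivity : (0 : ℝ) ≤ κ * |x| ^ α)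
  · exact (continuous_coe_real_ereal.comp
      ((continuous_abs.rpow_const fun _ => .inr hα.le).const_mul κ)).lowerSemicontinuous
  · exact fun F _ c hc => eventually_measureReal_empiricalMean_mem_le_exp_rpow hX hlaw hα hα1 hκ
      hmean h.integrable_exp hc
  · exact fun U hU x hx c hc => eventually_le_measureReal_empiricalMean_mem_exp_rpow hX hlaw hα hκ
      hmean h hU hx (EReal.coe_lt_coe_iff.mp hc)

end StretchedExponentialLDP

section SignedPowers

open Set

variable {μ : Measure ℝ} {p : ℝ}

theorem signedPow_neg (p x : ℝ) : signedPow p (-x) = -signedPow p x := by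
  simp [signedPow, Real.sign_neg]

theorem signedPow_of_pos (p : ℝ) {x : ℝ} (hx : 0 < x) : signedPow p x = x ^ p := by
  rw [signedPow, Real.sign_of_pos hx, one_mul, abs_of_pos hx]

theorem abs_signedPow (hp : p ≠ 0) (x : ℝ) : |signedPow p x| = |x| ^ p := by
  rcases eq_or_ne x 0 with rfl | hx
  · simp [signedPow, Real.zero_rpow hp]
  · rcases Real.sign_apply_eq_of_ne_zero x hx with h | h <;>
      simp [signedPow, h, abs_of_nonneg (Real.rpow_nonneg (abs_nonneg x) p)]

theorem measurable_signedPow (p : ℝ) : Measurable (signedPow p) := by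
  have hsign : Measurable Real.sign :=
    .ite measurableSet_Iio measurable_const <|
      .ite measurableSet_Ioi measurable_const measurable_const
  unfold signedPow
  fun_prop

theorem le_signedPow_of_rpow_le (hp : 0 < p) {t x : ℝ} (ht : 0 < t) (hx : t ^ (1 / p) ≤ x) :
    t ≤ signedPow p x := by
  rw [signedPow_of_pos p ((by positivity : 0 < t ^ (1 / p)).trans_le hx)]
  calc t = (t ^ (1 / p)) ^ p := by
        rw [← Real.rpow_mul ht.le, one_div_mul_cancel hp.ne', Real.rpow_one]
    _ ≤ x ^ p := by gcongr

theorem HasStretchedExpTails.map_signedPow [IsFiniteMeasure μ] {κ α : ℝ}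
    (h : HasStretchedExpTails μ κ α) (hp : 0 < p) :
    HasStretchedExpTails (μ.map (signedPow p)) κ (α / p) := by
  have hroot : Tendsto (fun t : ℝ => t ^ (1 / p)) atTop atTop := tendsto_rpow_atTop (by positivity)
  have hpow {t : ℝ} (ht : 0 < t) : (t ^ (1 / p)) ^ α = t ^ (α / p) := by
    rw [← Real.rpow_mul ht.le, one_div_mul_eq_div]
  refine ⟨fun s hs => ?_, fun c hc => ?_, fun c hc => ?_⟩
  · rw [integrable_map_measure (Measurable.aestronglyMeasurable (by fun_prop))
      (measurable_signedPow p).aemeasurable]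
    refine (h.integrable_exp s hs).congr (ae_of_all _ fun x => ?_)
    simp only [Function.comp_apply]
    rw [abs_signedPow hp.ne', ← Real.rpow_mul (abs_nonneg x), mul_div_cancel₀ _ hp.ne']
  · filter_upwards [hroot.eventually (h.le_Ici c hc), eventually_gt_atTop 0] with t hle ht
    rw [map_measureReal_apply (measurable_signedPow p) measurableSet_Ici, ← hpow ht]
    exact hle.trans (measureReal_mono fun x hx => le_signedPow_of_rpow_le hp ht hx)
  · filter_upwards [hroot.eventually (h.le_Iic c hc), eventually_gt_atTop 0] with t hle ht
    rw [map_measureReal_apply (measurable_signedPow p) measurableSet_Iic, ← hpow ht]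
    refine hle.trans (measureReal_mono fun x hx => ?_)
    have := le_signedPow_of_rpow_le hp ht (le_neg_of_le_neg hx)
    rw [signedPow_neg] at this
    exact le_neg_of_le_neg this

theorem integral_id_map_signedPow_of_map_neg_eq (hμ : μ.map (-·) = μ) (p : ℝ) :
    ∫ x, x ∂μ.map (signedPow p) = 0 := by
  have hodd : ∫ x, signedPow p x ∂μ = -∫ x, signedPow p x ∂μ := by
    calc ∫ x, signedPow p x ∂μ = ∫ x, signedPow p x ∂μ.map (-·) := by rw [hμ]
      _ = ∫ x, signedPow p (-x) ∂μ :=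
        integral_map measurable_neg.aemeasurable (measurable_signedPow p).aestronglyMeasurable
      _ = -∫ x, signedPow p x ∂μ := by simp only [signedPow_neg, integral_neg]
  rw [integral_map (measurable_signedPow p).aemeasurable (by fun_prop)]
  linarith

end SignedPowers

section GaussianTails

open Set

theorem gaussianReal_zero_map_neg (v : NNReal) :
    (gaussianReal 0 v).map (-·) = gaussianReal 0 v := by
  rw [gaussianReal_map_neg, neg_zero]

theorem integrable_exp_mul_sq_gaussianReal {s : ℝ} (hs : s < 1 / 2) :
    Integrable (fun x => Real.exp (s * x ^ 2)) (gaussianReal 0 1) := by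
  rw [gaussianReal_of_var_ne_zero _ one_ne_zero, integrable_withDensity_iff
    (measurable_gaussianPDF 0 1) (ae_of_all _ fun _ => gaussianPDF_lt_top)]
  have h (x : ℝ) : Real.exp (s * x ^ 2) * (gaussianPDF 0 1 x).toReal =
      (√(2 * Real.pi))⁻¹ * Real.exp (-(1 / 2 - s) * x ^ 2) := by
    rw [toReal_gaussianPDF, gaussianPDFReal]
    simp only [NNReal.coe_one, mul_one, sub_zero]
    rw [mul_left_comm, ← Real.exp_add]
    ring_nf
  simp only [h]
  exact (integrable_exp_neg_mul_sq (sub_pos.mpr hs)).const_mul _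

theorem mul_exp_le_gaussianReal_Ici {u v : ℝ} (hu : 0 ≤ u) (huv : u ≤ v) :
    (v - u) * ((√(2 * Real.pi))⁻¹ * Real.exp (-v ^ 2 / 2)) ≤ (gaussianReal 0 1).real (Ici u) := by
  calc (v - u) * ((√(2 * Real.pi))⁻¹ * Real.exp (-v ^ 2 / 2))
      = ∫ x in Icc u v, (√(2 * Real.pi))⁻¹ * Real.exp (-v ^ 2 / 2) := by
        rw [setIntegral_const, smul_eq_mul, Real.volume_real_Icc_of_le huv]
    _ ≤ ∫ x in Icc u v, gaussianPDFReal 0 1 x := by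
        refine setIntegral_mono_on (integrableOn_const (by simp))
          (integrable_gaussianPDFReal 0 1).integrableOn measurableSet_Icc fun x hx => ?_
        simp only [gaussianPDFReal, NNReal.coe_one, mul_one, sub_zero]
        have : x ^ 2 ≤ v ^ 2 := pow_le_pow_left₀ (hu.trans hx.1) hx.2 2
        gcongr
    _ = (gaussianReal 0 1).real (Icc u v) := by
        rw [measureReal_def, gaussianReal_apply_eq_integral 0 one_ne_zero,
          ENNReal.toReal_ofReal (integral_nonneg fun x => gaussianPDFReal_nonneg _ _ _)]
    _ ≤ (gaussianReal 0 1).real (Ici u) := measureReal_mono Icc_subset_Ici_self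

theorem eventually_exp_le_gaussianReal_Ici {c : ℝ} (hc : 1 / 2 < c) :
    ∀ᶠ t in atTop, Real.exp (-c * t ^ 2) ≤ (gaussianReal 0 1).real (Ici t) := by
  obtain ⟨b, hb, hbc⟩ : ∃ b, 1 < b ∧ b ^ 2 / 2 < c := by
    have hlim : ContinuousAt (fun b : ℝ => b ^ 2 / 2) 1 := by fun_prop
    have hev := (hlim.eventually_lt_const (by simpa using hc)).filter_mono
      (nhdsWithin_le_nhds (s := Ioi 1))
    exact (eventually_mem_nhdsWithin.and hev).exists
  have hK : 0 < (b - 1) * (√(2 * Real.pi))⁻¹ := mul_pos (sub_pos.mpr hb) (by positivity)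
  filter_upwards [eventually_mul_exp_le_exp (K := ((b - 1) * (√(2 * Real.pi))⁻¹)⁻¹) hbc
    (tendsto_pow_atTop two_ne_zero), eventually_ge_atTop 1] with t hslack ht
  rw [inv_mul_le_iff₀ hK] at hslack
  have hstep : b - 1 ≤ b * t - t := by nlinarith
  calc Real.exp (-c * t ^ 2)
      ≤ (b - 1) * (√(2 * Real.pi))⁻¹ * Real.exp (-(b ^ 2 / 2) * t ^ 2) := hslack
    _ ≤ (b * t - t) * (√(2 * Real.pi))⁻¹ * Real.exp (-(b ^ 2 / 2) * t ^ 2) := by gcongr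
    _ = (b * t - t) * ((√(2 * Real.pi))⁻¹ * Real.exp (-(b * t) ^ 2 / 2)) := by ring_nf
    _ ≤ (gaussianReal 0 1).real (Ici t) :=
        mul_exp_le_gaussianReal_Ici (zero_le_one.trans ht) (by nlinarith)

theorem hasStretchedExpTails_gaussianReal : HasStretchedExpTails (gaussianReal 0 1) (1 / 2) 2 where
  integrable_exp s hs := by
    simpa only [Real.rpow_two, sq_abs] using integrable_exp_mul_sq_gaussianReal hs
  le_Ici c hc := by
    simpa only [Real.rpow_two] using eventually_exp_le_gaussianReal_Ici hc
  le_Iic c hc := by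
    filter_upwards [eventually_exp_le_gaussianReal_Ici hc] with t ht
    rw [← gaussianReal_zero_map_neg, map_measureReal_apply measurable_neg measurableSet_Ici] at ht
    simpa using ht

end GaussianTails

theorem proposition2_general {Ω₀ Ω : Type*} [MeasurableSpace Ω₀] [MeasurableSpace Ω]
    (P₀ : Measure Ω₀) [IsProbabilityMeasure P₀] (P : Measure Ω) (Z : Ω₀ → ℝ)
    (X : ℕ → Ω → ℝ) (hindep : iIndepFun X P) (hident : ∀ i, IdentDistrib (X i) Z P P₀) :
    SatisfiesLDP P (empiricalMean X) (fun n => (n : ℝ)) (legendreTransform (freeEnergy P₀ Z)) ∧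
    ∀ p, 2 < p → HasLaw Z ((gaussianReal 0 1).map (signedPow p)) P₀ →
      SatisfiesLDP P (empiricalMean X) (fun n => (n : ℝ) ^ (2 / p))
        (fun x => ((|x| ^ (2 / p) / 2 : ℝ) : EReal)) := by
  have hZ : AEMeasurable Z P₀ := (hident 0).aemeasurable_snd
  have hlaw (i : ℕ) : HasLaw (X i) (P₀.map Z) P := ⟨(hident i).aemeasurable_fst, (hident i).map_eq⟩
  have := Measure.isProbabilityMeasure_map hZ
  refine ⟨?_, fun p hp hZp => ?_⟩
  · rw [funext (freeEnergy_eq_log_expMoment ⟨hZ, rfl⟩)]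
    exact satisfiesLDP_empiricalMean_legendreTransform hindep hlaw
  · have hp0 : 0 < p := two_pos.trans hp
    have hmean := integral_id_map_signedPow_of_map_neg_eq (gaussianReal_zero_map_neg 1) p
    have htails := hasStretchedExpTails_gaussianReal.map_signedPow hp0
    rw [← hZp.map_eq] at hmean htails
    simpa only [one_div, inv_mul_eq_div] using htails.satisfiesLDP_empiricalMean hindep hlaw
      (by positivity) ((div_lt_one hp0).mpr hp) one_half_pos hmean

theorem proposition2 {Ω₀ Ω : Type*} [MeasurableSpace Ω₀] [MeasurableSpace Ω]
    (P₀ : Measure Ω₀) [IsProbabilityMeasure P₀] (P : Measure Ω) [IsProbabilityMeasure P]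
    (G : Ω₀ → ℝ) (hG : HasLaw G (gaussianReal 0 1) P₀)
    (p : ℝ) (Z : Ω₀ → ℝ) (hZ : Z = fun ω => signedPow p (G ω))
    (X : ℕ → Ω → ℝ) (hindep : iIndepFun X P) (hident : ∀ i, IdentDistrib (X i) Z P P₀) :
    (0 < p → p ≤ 2 →
      SatisfiesLDP P (empiricalMean X) (fun n => (n : ℝ))
        (legendreTransform (freeEnergy P₀ Z))) ∧
    (2 < p →
      SatisfiesLDP P (empiricalMean X) (fun n => (n : ℝ) ^ (2 / p))
        (fun x => ((|x| ^ (2 / p) / 2 : ℝ) : EReal))) := by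
  obtain ⟨hcramer, hstretched⟩ := proposition2_general P₀ P Z X hindep hident
  exact ⟨fun _ _ => hcramer, fun hp => hstretched p hp <| hZ ▸
    (HasLaw.mk (measurable_signedPow p).aemeasurable rfl).fun_comp hG⟩
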